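/- Let $n\ge 1$. Over $\mathbb{C}$, let $$Y=\mathbb{V}\big(xz-y(y+t^n)\big)\subset\mathbb{A}^4_{x,y,z,t},\qquad P=0\in Y,$$ and let $D=\mathbb{V}(yt)=D_1+D_2+D_3\subset Y$ with $D_1=\mathbb{V}(x,y)$, $D_2=\mathbb{V}(y,z)$, $D_3=\mathbb{V}(xz-y^2,t)$. The two small resolutions of $Y$ are the projections to $Y$ of $$X=\mathbb{V}\big(y\alpha-z\beta,\ x\alpha-(y+t^n)\beta\big),\qquad X'=\mathbb{V}\big(y\alpha-x\beta,\ z\alpha-(y+t^n)\beta\big)\ \subset\ \mathbb{A}^4\times\mathbb{P}^1_{\alpha:\beta}.$$ Denote by $\widetilde D_i\subset X$, $\widetilde D_i'\subset X'$ the strict transforms of $D_i$, by $\widetilde D$, $\widetilde D'$ their sums, and by $C\subset X$, $C'\subset X'$ the preimages of $P$. The strata of $\widetilde D$ are the components $\widetilde D_i$ and, inductively, all irreducible components of intersections of strata; the intersection complex of $(X,\widetilde D)$ is the set of strata ordered by inclusion (similarly for $X'$). Let $U^{\mathrm{trop}}$ be $\mathbb{R}^3$, with coordinates $(a,b,c)$,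 integral points $\mathbb{Z}^3$ and singular line $\ell=\mathbb{R}(n,n,1)$, where $\mathbb{R}^3\setminus\ell$ carries the integral affine structure in which tangent vectors of straight lines are multiplied by $$M_\ell=\begin{pmatrix}1&1&-n\\0&1&0\\0&0&1\end{pmatrix}$$ on passing through the half-plane $H^+=\{b=nc,\ a>nc\}$ in the direction $(0,-1,n)$, and which is the standard one away from $H^+$. Equivalently, its charts are the identity on $\mathbb{R}^3\setminus(H^+\cup\ell)$, and, on $\mathbb{R}^3\setminus(H^-\cup\ell)$ with $H^-=\{b=nc,\ a<nc\}$, the map equal to the identity where $b\ge nc$ and to $M_\ell^{-1}$ where $b\le nc$. Let $$d_1=(1,1,0),\quad d_2=(0,1,0),\quad d_3=(0,0,1),\qquad \rho_i=\mathbb{R}_{\ge0}d_i,$$ $$\sigma=\{a\ge0,\ c\ge0,\ a\le 2b,\ a\le b+nc\}.$$ Call a subset of $\sigma$ a straight planar sector joining $\rho_i$ and $\rho_j$, $i\neq j$, if it is the closure of its part away from $\ell$, and this part lies in the domain of one of the two charts and has image in $\mathbb{R}^3$ with closure the cone spanned by the images of $d_i,d_j$. The two-dimensional faces of $\sigma$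 are the straight planar sectors that do not meet the interior of $\sigma$; a subdividing plane of $\sigma$ is a straight planar sector that does. For a subdividing plane $\Pi$, the cones of the subdivision of $\sigma$ along $\Pi$ are the rays $\rho_1,\rho_2,\rho_3$, the two-dimensional faces of $\sigma$, the plane $\Pi$, and the closures of the connected components of $\sigma\setminus\Pi$. Theorem. With $v=(n,n,1)$: (1) $\sigma$ has exactly two subdividing planes, $\Pi_{23}=\langle d_2,v\rangle\cup\langle v,d_3\rangle$, joining $\rho_2$ and $\rho_3$, and $\Pi_{13}=\langle d_1,v\rangle\cup\langle v,d_3\rangle$, joining $\rho_1$ and $\rho_3$. (2) The intersection complex of $(X,\widetilde D)$ is dual to the subdivision of $\sigma$ along $\Pi_{23}$: there is an inclusion-reversing bijection (with inclusion-reversing inverse) from the cones of this subdivision to the strata of $\widetilde D$, under which $\rho_i$ corresponds to $\widetilde D_i$ for $i=1,2,3$, and $\Pi_{23}$ corresponds to $C$. (3) In the same sense, the intersection complex of $(X',\widetilde D')$ is dual to the subdivision of $\sigma$ along $\Pi_{13}$, where $\rho_i$ corresponds to $\widetilde D_i'$ for $i=1,2,3$, and $\Pi_{13}$ corresponds to $C'$.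 -/

import Mathlib

open Set Topology

/-! ## Integral affine manifolds with singularities -/

/-- An integral affine structure with singular locus `Δ` on a space `B`: an atlas on `B ∖ Δ` with
values in `ℝᵈ`, whose changes of charts are locally of the form `v ↦ A v + b` with
`A ∈ GL_d(ℤ)`, `b ∈ ℤᵈ`, and a set of integral points of `B` which away from `Δ` is the set of
points with integral coordinates. -/
structure IntegralAffineStructure {B : Type} [TopologicalSpace B] (Δ : Set B) (d : ℕ) where
  charts : Set (OpenPartialHomeomorph B (Fin d → ℝ))
  iUnion_source : (⋃ e ∈ charts, e.source) = Δᶜ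
  transition : ∀ e ∈ charts, ∀ e' ∈ charts, ∀ p ∈ e.source ∩ e'.source,
    ∃ (A : Matrix.GeneralLinearGroup (Fin d) ℤ) (b : Fin d → ℤ), ∀ᶠ q in 𝓝 p,
      e' q = ((A : Matrix (Fin d) (Fin d) ℤ).map (Int.cast : ℤ → ℝ)).mulVec (e q)
        + fun k => (b k : ℝ)
  integralPoints : Set B
  integral_iff : ∀ e ∈ charts, ∀ p ∈ e.source,
    p ∈ integralPoints ↔ ∃ m : Fin d → ℤ, e p = fun k => (m k : ℝ)

/-- The closed convex cone `ℝ≥0 p + ℝ≥0 q` in `ℝᵈ`. -/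
def planarCone {d : ℕ} (p q : Fin d → ℝ) : Set (Fin d → ℝ) :=
  {v | ∃ s t : ℝ, 0 ≤ s ∧ 0 ≤ t ∧ v = s • p + t • q}

/-- `W` is a straight planar sector bounded by the rays through `p` and `q`: the closure of its
part away from `Δ`, which lies in the domain of one chart and which that chart sends to the planar
cone spanned by the images of `p` and `q` (up to points of the closure: `W` may touch `Δ`). -/
def IntegralAffineStructure.IsStraightSector {B : Type} [TopologicalSpace B] {Δ : Set B} {d : ℕ}
    (𝒜 : IntegralAffineStructure Δ d) (p q : B) (W : Set B) : Prop :=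
  closure (W \ Δ) = W ∧
    ∃ e ∈ 𝒜.charts, p ∈ e.source ∧ q ∈ e.source ∧ W \ Δ ⊆ e.source ∧
      closure (e '' (W \ Δ)) = planarCone (e p) (e q)

/-! ## The tropicalisation `U^trop` -/

/-- The real vector space `N_ℝ = ℝ³` underlying `U^trop`. -/
abbrev NR : Type := Fin 3 → ℝ

/-- The singular line `ℓ = ℝ (n, n, 1)`. -/
def singularLine (n : ℕ) : Set NR := {v | ∃ s : ℝ, v = s • ![(n : ℝ), n, 1]}

/-- The closed half of the plane `H = (0, -1, n)^⊥` on the side of `ℓ` containing `(1, 0, 0)`;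
the open half-plane `H⁺` is its complement of `ℓ`. -/
def closedHalfPlanePos (n : ℕ) : Set NR := {v | v 1 = n * v 2 ∧ n * v 2 ≤ v 0}

/-- The opposite closed half of the plane `H`; the open half-plane `H⁻` is its complement
of `ℓ`. -/
def closedHalfPlaneNeg (n : ℕ) : Set NR := {v | v 1 = n * v 2 ∧ v 0 ≤ n * v 2}

/-- The monodromy matrix `M_ℓ`, by which tangent vectors are multiplied on passing through `H⁺` in
the direction `(0, -1, n)`. -/
def monodromy (n : ℕ) : Matrix (Fin 3) (Fin 3) ℤ := !![1, 1, -n; 0, 1, 0; 0, 0, 1]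

/-- The inverse of the monodromy matrix. -/
def monodromyInv (n : ℕ) : Matrix (Fin 3) (Fin 3) ℤ := !![1, -1, n; 0, 1, 0; 0, 0, 1]

/-- The monodromy matrix as an element of `GL₃(ℤ)`. -/
def monodromyGL (n : ℕ) : Matrix.GeneralLinearGroup (Fin 3) ℤ where
  val := monodromy n
  inv := monodromyInv n
  val_inv := by
    ext i j; fin_cases i <;> fin_cases j <;>
      simp [monodromy, monodromyInv, Matrix.mul_apply, Fin.sum_univ_three]
  inv_val := by
    ext i j; fin_cases i <;> fin_cases j <;>
      simp [monodromy, monodromyInv, Matrix.mul_apply, Fin.sum_univ_three]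

/-- The map that develops `U^trop` through `H⁺`: the identity on the side `⟨v, (0,-1,n)⟩ ≤ 0` of
`H`, and `M_ℓ⁻¹` on the side `⟨v, (0,-1,n)⟩ ≥ 0` (see the lemmas below). -/
noncomputable def unbend (n : ℕ) : NR ≃ₜ NR where
  toFun v := ![v 0 + max (n * v 2 - v 1) 0, v 1, v 2]
  invFun v := ![v 0 - max (n * v 2 - v 1) 0, v 1, v 2]
  left_inv v := by ext i; fin_cases i <;> simp
  right_inv v := by ext i; fin_cases i <;> simp
  continuous_toFun := by
    refine continuous_pi fun i => ?_
    fin_cases i <;> simp <;> fun_prop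
  continuous_invFun := by
    refine continuous_pi fun i => ?_
    fin_cases i <;> simp <;> fun_prop

theorem unbend_of_le (n : ℕ) (v : NR) (h : n * v 2 ≤ v 1) : unbend n v = v := by
  ext i; fin_cases i <;> simp [unbend, h]

theorem monodromy_mulVec_unbend (n : ℕ) (v : NR) (h : v 1 ≤ n * v 2) :
    ((monodromy n).map (Int.cast : ℤ → ℝ)).mulVec (unbend n v) = v := by
  ext i; fin_cases i <;>
    simp [unbend, monodromy, Matrix.mulVec, dotProduct, Fin.sum_univ_three, h]
  ring

theorem unbend_of_ge (n : ℕ) (v : NR) (h : v 1 ≤ n * v 2) :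
    ((monodromyInv n).map (Int.cast : ℤ → ℝ)).mulVec v = unbend n v := by
  ext i; fin_cases i <;>
    simp [unbend, monodromyInv, Matrix.mulVec, dotProduct, Fin.sum_univ_three, h]
  ring

theorem isClosed_closedHalfPlanePos (n : ℕ) : IsClosed (closedHalfPlanePos n) := by
  have h0 : Continuous fun v : NR => v 0 := by fun_prop
  have h1 : Continuous fun v : NR => v 1 := by fun_prop
  have h2 : Continuous fun v : NR => (n : ℝ) * v 2 := by fun_prop
  exact (isClosed_eq h1 h2).inter (isClosed_le h2 h0)

theorem isClosed_closedHalfPlaneNeg (n : ℕ) : IsClosed (closedHalfPlaneNeg n) := by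
  have h0 : Continuous fun v : NR => v 0 := by fun_prop
  have h1 : Continuous fun v : NR => v 1 := by fun_prop
  have h2 : Continuous fun v : NR => (n : ℝ) * v 2 := by fun_prop
  exact (isClosed_eq h1 h2).inter (isClosed_le h0 h2)

theorem mem_singularLine_iff (n : ℕ) (v : NR) :
    v ∈ singularLine n ↔ v 1 = n * v 2 ∧ v 0 = n * v 2 := by
  constructor
  · rintro ⟨s, rfl⟩
    simp [mul_comm]
  · rintro ⟨h1, h0⟩
    refine ⟨v 2, ?_⟩
    ext i; fin_cases i <;> simp [h1, h0, mul_comm]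

/-- The chart of `U^trop` given by the identity away from the closed half-plane `H⁺ ∪ ℓ`: lines
that do not meet `H⁺` do not bend. -/
noncomputable def chartNeg (n : ℕ) : OpenPartialHomeomorph NR NR :=
  (Homeomorph.refl NR).toOpenPartialHomeomorph.restrOpen (closedHalfPlanePos n)ᶜ
    (isClosed_closedHalfPlanePos n).isOpen_compl

/-- The chart of `U^trop` given by `unbend n` away from the closed half-plane `H⁻ ∪ ℓ`: lines
that pass through `H⁺` bend by `M_ℓ^{±1}`. -/
noncomputable def chartPos (n : ℕ) : OpenPartialHomeomorph NR NR :=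
  (unbend n).toOpenPartialHomeomorph.restrOpen (closedHalfPlaneNeg n)ᶜ
    (isClosed_closedHalfPlaneNeg n).isOpen_compl

theorem chartNeg_apply (n : ℕ) (v : NR) : chartNeg n v = v := rfl

theorem chartPos_apply (n : ℕ) (v : NR) : chartPos n v = unbend n v := rfl

theorem chartNeg_source (n : ℕ) : (chartNeg n).source = (closedHalfPlanePos n)ᶜ := by
  simp [chartNeg]

theorem chartPos_source (n : ℕ) : (chartPos n).source = (closedHalfPlaneNeg n)ᶜ := by
  simp [chartPos]

theorem unbend_locally_linear (n : ℕ) (p : NR) (h1 : p ∉ closedHalfPlanePos n)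
    (h2 : p ∉ closedHalfPlaneNeg n) :
    (∀ᶠ q in 𝓝 p, unbend n q = q) ∨ (∀ᶠ q : NR in 𝓝 p, q 1 ≤ (n : ℝ) * q 2) := by
  have hne : p 1 ≠ n * p 2 := by
    intro h
    rcases le_total (n * p 2) (p 0) with h' | h'
    · exact h1 ⟨h, h'⟩
    · exact h2 ⟨h, h'⟩
  have hc1 : Continuous fun q : NR => q 1 := by fun_prop
  have hc2 : Continuous fun q : NR => (n : ℝ) * q 2 := by fun_prop
  rcases lt_or_gt_of_ne hne with h | h
  · right
    filter_upwards [hc1.continuousAt.eventually_lt hc2.continuousAt h] with q hq using hq.le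
  · left
    filter_upwards [hc2.continuousAt.eventually_lt hc1.continuousAt h] with q hq
    exact unbend_of_le n q hq.le

/-- The integral affine manifold with singularities `U^trop`: the manifold `ℝ³` with singular line
`ℓ = ℝ (n, n, 1)`, integral points `ℤ³`, and the integral affine structure on `ℝ³ ∖ ℓ` in which
straight lines bend by `M_ℓ` when passing through `H⁺` in the direction `(0, -1, n)`. -/
noncomputable def tropU (n : ℕ) : IntegralAffineStructure (singularLine n) 3 where
  charts := {chartNeg n, chartPos n}
  iUnion_source := by
    ext v
    simp only [mem_insert_iff, mem_singleton_iff, iUnion_iUnion_eq_or_left, iUnion_iUnion_eq_left,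
      chartNeg_source, chartPos_source, mem_union, mem_compl_iff, mem_singularLine_iff,
      closedHalfPlanePos, closedHalfPlaneNeg, mem_ofPred_eq]
    constructor
    · rintro (h | h) ⟨h1, h0⟩
      · exact h ⟨h1, h0.ge⟩
      · exact h ⟨h1, h0.le⟩
    · intro h
      by_contra hc
      push Not at hc
      exact h ⟨hc.1.1, le_antisymm hc.2.2 hc.1.2⟩
  transition := by
    rintro e (rfl | rfl) e' (rfl | rfl) p ⟨hp, hp'⟩
    · exact ⟨1, 0, Filter.Eventually.of_forall fun q => by
        ext i; simp [chartNeg_apply]⟩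
    · rw [chartNeg_source] at hp
      rw [chartPos_source] at hp'
      rcases unbend_locally_linear n p hp hp' with h | h
      · refine ⟨1, 0, ?_⟩
        filter_upwards [h] with q hq
        ext i; simp [chartNeg_apply, chartPos_apply, hq]
      · refine ⟨(monodromyGL n)⁻¹, 0, ?_⟩
        filter_upwards [h] with q hq
        rw [chartNeg_apply, chartPos_apply, ← unbend_of_ge n q hq]
        ext i
        simp only [Pi.zero_apply, Int.cast_zero, Pi.add_apply, add_zero]
        rfl
    · rw [chartPos_source] at hp
      rw [chartNeg_source] at hp'
      rcases unbend_locally_linear n p hp' hp with h | h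
      · refine ⟨1, 0, ?_⟩
        filter_upwards [h] with q hq
        ext i; simp [chartNeg_apply, chartPos_apply, hq]
      · refine ⟨monodromyGL n, 0, ?_⟩
        filter_upwards [h] with q hq
        have := monodromy_mulVec_unbend n q hq
        rw [chartNeg_apply, chartPos_apply]
        nth_rewrite 1 [← this]
        ext i
        simp only [Pi.zero_apply, Int.cast_zero, Pi.add_apply, add_zero]
        rfl
    · exact ⟨1, 0, Filter.Eventually.of_forall fun q => by
        ext i; simp [chartPos_apply]⟩
  integralPoints := {v | ∃ m : Fin 3 → ℤ, v = fun k => (m k : ℝ)}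
  integral_iff := by
    rintro e (rfl | rfl) p -
    · rfl
    · constructor
      · rintro ⟨m, rfl⟩
        refine ⟨![m 0 + max (n * m 2 - m 1) 0, m 1, m 2], ?_⟩
        rw [chartPos_apply]
        ext i; fin_cases i <;> simp [unbend]
      · rintro ⟨m, hm⟩
        rw [chartPos_apply] at hm
        refine ⟨![m 0 - max (n * m 2 - m 1) 0, m 1, m 2], ?_⟩
        have : p = (unbend n).symm (unbend n p) := ((unbend n).symm_apply_apply p).symm
        rw [this, hm]
        ext i; fin_cases i <;> simp [unbend]

/-! ## The cone `σ` and its subdivisions -/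

/-- The integral points `d₁ = (1, 1, 0)`, `d₂ = (0, 1, 0)`, `d₃ = (0, 0, 1)` of `U^trop`: the
orders of vanishing of `(x, y, t)` along `D₁`, `D₂`, `D₃`. The indices `1, 2, 3` are
`0, 1, 2` here. -/
def dPoint : Fin 3 → NR := ![![1, 1, 0], ![0, 1, 0], ![0, 0, 1]]

/-- The rays `ρ₁`, `ρ₂`, `ρ₃`. -/
def rho (i : Fin 3) : Set NR := {v | ∃ s : ℝ, 0 ≤ s ∧ v = s • dPoint i}

/-- The cone `σ`, cut out by the planes `(1,0,0)^⊥`, `(0,0,1)^⊥`, `(1,-2,0)^⊥`,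
`(1,-1,-n)^⊥`. -/
def sigma (n : ℕ) : Set NR :=
  {v | 0 ≤ v 0 ∧ 0 ≤ v 2 ∧ v 0 - 2 * v 1 ≤ 0 ∧ v 0 - v 1 - n * v 2 ≤ 0}

/-- `W ⊆ σ` is a straight planar sector of `U^trop` joining two different rays `ρᵢ`, `ρⱼ`. -/
def IsSectorOfSigma (n : ℕ) (W : Set NR) : Prop :=
  W ⊆ sigma n ∧ ∃ i j, i ≠ j ∧ (tropU n).IsStraightSector (dPoint i) (dPoint j) W

/-- The two-dimensional faces of `σ` with respect to the affine structure of `U^trop`. -/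
def IsFaceOfSigma (n : ℕ) (W : Set NR) : Prop :=
  IsSectorOfSigma n W ∧ Disjoint W (interior (sigma n))

/-- A plane of `U^trop` that joins two rays of `σ` through the interior of `σ`. -/
def IsSubdividingPlane (n : ℕ) (W : Set NR) : Prop :=
  IsSectorOfSigma n W ∧ (W ∩ interior (sigma n)).Nonempty

/-- The cones of positive dimension of the subdivision of `σ` along a subdividing plane `P`: the
rays and the two-dimensional faces of `σ`, the plane `P`, and the closures of the connected
components of `σ ∖ P`. -/
def subdivisionCones (n : ℕ) (P : Set NR) : Set (Set NR) :=
  range rho ∪ {W | IsFaceOfSigma n W} ∪ {P} ∪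
    {τ | ∃ v ∈ sigma n \ P, τ = closure (connectedComponentIn (sigma n \ P) v)}

/-- The plane `⟨ρᵢ, ℓ⟩ ∪ ⟨ℓ, ρ₃⟩` through the singular ray `ℝ≥0 (n, n, 1)`. -/
def planeThrough (n : ℕ) (i : Fin 3) : Set NR :=
  planarCone (dPoint i) ![(n : ℝ), n, 1] ∪ planarCone ![(n : ℝ), n, 1] (dPoint 2)

/-- The subdividing plane between `ρ₂` and `ρ₃`, of the lefthand subdivision. -/
def leftPlane (n : ℕ) : Set NR := planeThrough n 1

/-- The subdividing plane between `ρ₁` and `ρ₃`, of the righthand subdivision. -/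
def rightPlane (n : ℕ) : Set NR := planeThrough n 0

/-! ## The base of the flop and its two small resolutions -/

/-- The hypersurface `Y = V(xz - y(y + tⁿ)) ⊂ 𝔸⁴` over `ℂ`, with coordinates `(x, y, z, t)`. -/
def Y (n : ℕ) : Set (Fin 4 → ℂ) := {p | p 0 * p 2 = p 1 * (p 1 + p 3 ^ n)}

/-- The components `D₁ = V(x, y)`, `D₂ = V(y, z)`, `D₃ = V(xz - y², t)` of `D = V(yt) ⊂ Y`. -/
def boundary (n : ℕ) : Fin 3 → Set (Fin 4 → ℂ) :=
  ![{p ∈ Y n | p 0 = 0 ∧ p 1 = 0}, {p ∈ Y n | p 1 = 0 ∧ p 2 = 0},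
    {p ∈ Y n | p 0 * p 2 = p 1 ^ 2 ∧ p 3 = 0}]

/-- The closed points of `𝔸⁴ × ℙ¹` over `ℂ`. A separate structure, so that it carries the Zariski
topology below. -/
structure AffProj where
  pt : Fin 4 → ℂ
  dir : Projectivization ℂ (Fin 2 → ℂ)

/-- The value of a polynomial in `x, y, z, t; α, β` at a point of `𝔸⁴ × ℙ¹`, at a chosen
representative of the point of `ℙ¹`; whether it vanishes is independent of that choice if the
polynomial is homogeneous in `α, β`. -/
noncomputable def AffProj.eval (q : AffProj) (F : MvPolynomial (Fin 4 ⊕ Fin 2) ℂ) : ℂ :=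
  MvPolynomial.eval (Sum.elim q.pt q.dir.rep) F

/-- The Zariski topology: the sets `{F ≠ 0}`, for `F` homogeneous in `α, β`, are a basis. -/
instance : TopologicalSpace AffProj :=
  TopologicalSpace.generateFrom {O | ∃ (F : MvPolynomial (Fin 4 ⊕ Fin 2) ℂ) (k : ℕ),
    MvPolynomial.IsWeightedHomogeneous (Sum.elim (fun _ => 0) (fun _ => 1)) F k ∧
      O = {q | q.eval F ≠ 0}}

/-- The small resolution `X = V(yα - zβ, xα - (y + tⁿ)β)` of `Y`. -/
def smallResolution (n : ℕ) : Set AffProj :=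
  {q | q.pt 1 * q.dir.rep 0 = q.pt 2 * q.dir.rep 1 ∧
    q.pt 0 * q.dir.rep 0 = (q.pt 1 + q.pt 3 ^ n) * q.dir.rep 1}

/-- The other small resolution `X' = V(yα - xβ, zα - (y + tⁿ)β)` of `Y`: here `(α : β) = (x : y)`
and `X'` is the blowup of `D₁ = V(x, y)`, as `X` is that of `D₂ = V(y, z)`. -/
def otherResolution (n : ℕ) : Set AffProj :=
  {q | q.pt 1 * q.dir.rep 0 = q.pt 0 * q.dir.rep 1 ∧
    q.pt 2 * q.dir.rep 0 = (q.pt 1 + q.pt 3 ^ n) * q.dir.rep 1}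

/-- Both resolutions map to `Y` by the projection `f = AffProj.pt`. -/
theorem pt_mem_Y (n : ℕ) (q : AffProj)
    (hq : q ∈ smallResolution n ∪ otherResolution n) : q.pt ∈ Y n := by
  have hne := q.dir.rep_nonzero
  have h01 : q.dir.rep 0 ≠ 0 ∨ q.dir.rep 1 ≠ 0 := by
    by_contra h
    push Not at h
    exact hne (by ext i; fin_cases i <;> simp [h.1, h.2])
  simp only [Y, mem_ofPred_eq]
  rcases hq with ⟨h1, h2⟩ | ⟨h1, h2⟩ <;> rcases h01 with h | h <;>
    apply mul_right_cancel₀ h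
  · linear_combination (q.pt 2) * h2 - (q.pt 1 + q.pt 3 ^ n) * h1
  · linear_combination (q.pt 1) * h2 - (q.pt 0) * h1
  · linear_combination (q.pt 0) * h2 - (q.pt 1 + q.pt 3 ^ n) * h1
  · linear_combination (q.pt 1) * h2 - (q.pt 2) * h1

/-- The strict transforms in `Z` (one of the two resolutions) of the components of `D`: the closure
of their preimage away from the point `P = 0`, over whose complement `f` is an isomorphism. -/
def strictTransform (n : ℕ) (Z : Set AffProj) (i : Fin 3) : Set AffProj :=
  closure {q ∈ Z | q.pt ∈ boundary n i \ {0}}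

/-- The exceptional curve `f⁻¹(P)` in `Z`. -/
def exceptionalCurve (Z : Set AffProj) : Set AffProj := {q ∈ Z | q.pt = 0}

/-- `S` is an irreducible component of `T`. -/
def IsComponent (S T : Set AffProj) : Prop :=
  Maximal (fun R => IsIrreducible R ∧ R ⊆ T) S

/-- The closed strata (cells of the intersection complex) of a divisor `∑ Eᵢ`: the components of
the `Eᵢ`, and successively all components of intersections of strata. -/
inductive IsStratum (E : Fin 3 → Set AffProj) : Set AffProj → Prop
  | component (i : Fin 3) (S : Set AffProj) : IsComponent S (E i) → IsStratum E S
  | inter (S T R : Set AffProj) :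
      IsStratum E S → IsStratum E T → IsComponent R (S ∩ T) → IsStratum E R

/-! ## Duality -/

/-- The intersection complex of `(Z, D̃)` is dual to the subdivision of `σ` along `P`: there is an
inclusion-reversing bijection from the cones of the subdivision to the strata of `D̃`, under which
the rays `ρᵢ` correspond to the `D̃ᵢ`, and `P` to the exceptional curve. -/
def IntersectionComplexDual (n : ℕ) (Z : Set AffProj) (P : Set NR) : Prop :=
  ∃ Φ : Set NR → Set AffProj,
    BijOn Φ (subdivisionCones n P) {S | IsStratum (strictTransform n Z) S} ∧
    (∀ τ ∈ subdivisionCones n P, ∀ τ' ∈ subdivisionCones n P, τ ⊆ τ' ↔ Φ τ' ⊆ Φ τ) ∧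
    (∀ i, Φ (rho i) = strictTransform n Z i) ∧
    Φ P = exceptionalCurve Z

/-!
Both sides of the duality are finite posets with nine elements, and both are computed in
coordinates.

On the tropical side, put `w = min (b, nc)`. Then `σ` is the region `0 ≤ a ≤ b + w` over the
quadrant `b, c ≥ 0`. In the chart that avoids `H⁺` the cones over pairs of the `dᵢ` are contained
in `c = 0`, `a = 0` and `a = b`; in the chart that avoids `H⁻` they are contained in `c = 0`,
`a = b + w` and `a = w` (`isSectorOfSigma_iff`). Of these, `a = b` and `a = w` are the two that meet
the interior of `σ`. The plane `a = w` cuts `σ` into two parts, each convex in one of the charts;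
their closures are the three-dimensional cones (`closures_of_components`).

On the geometric side, the strict transforms `D̃ᵢ ⊂ X` and the strata obtained from them are written
down by equations (`Cell.stratum`). Each is irreducible because it is the image of an open subset of
an affine space under a polynomial map (`isIrreducible_of_parametrization`). Two strata meet in a
stratum or not at all, except that `D̃₂ ∩ D̃₃` is the union of the exceptional curve and the strict
transform of the `x`-axis (`Cell.stratum_inter_stratum`). This is why the subdivision has two
two-dimensional cones joining `ρ₂` and `ρ₃`. In both posets inclusion is decided by testing one
generic point of each member, and the answers agree.

The statement for `X'` follows by symmetry. The exchange of `x` and `z` maps `X` to `X'` and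
exchanges `D₁` with `D₂` (`swapHomeo`), and the involution `a ↦ b + w - a` of `U^trop` exchanges the
two subdividing planes and `ρ₁` with `ρ₂` (`reflection`).
-/

/-! ### The cones of the subdivision in coordinates -/

/-- The nine cells common to both sides of the duality, named after the cones on the tropical side
of the left-hand subdivision: the rays `ρᵢ`, the two-dimensional faces joining `ρᵢ` and `ρⱼ`, the
subdividing plane, and the three-dimensional cones containing, respectively not containing,
`ρ₁`. -/
inductive Cell
  | ray₁ | ray₂ | ray₃ | face₁₂ | face₁₃ | face₂₃ | plane | outer | inner

/-- The face poset of the nine cells, recorded by five features: the rays `ρ₁`, `ρ₂`, `ρ₃` (as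
`0, 1, 2`), the subdividing plane (as `3`) and the face joining `ρ₂` and `ρ₃` (as `4`). The last
two span the same pair of rays, so that the rays alone do not determine a cell. -/
def Cell.features : Cell → Finset (Fin 5)
  | ray₁ => {0}
  | ray₂ => {1}
  | ray₃ => {2}
  | face₁₂ => {0, 1}
  | face₁₃ => {0, 2}
  | face₂₃ => {1, 2, 4}
  | plane => {1, 2, 3}
  | outer => {0, 1, 2, 3}
  | inner => {1, 2, 3, 4}

/-- The height `min (b, nc)` over `(b, c)` of the subdividing plane through `ρ₂`. -/
noncomputable def wall (n : ℕ) (v : NR) : ℝ := min (v 1) (n * v 2)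

theorem continuous_wall (n : ℕ) : Continuous (wall n) := by
  unfold wall; fun_prop

/-- The cone of a cell, as a region over the quadrant `b, c ≥ 0`: all cones are cut out by comparing
`a` with the four functions `0`, `min (b, nc)`, `b`, `b + min (b, nc)` of `(b, c)`. -/
def Cell.cone (n : ℕ) (k : Cell) : Set NR :=
  {v | 0 ≤ v 1 ∧ 0 ≤ v 2 ∧ match k with
    | ray₁ => v 2 = 0 ∧ v 0 = v 1
    | ray₂ => v 2 = 0 ∧ v 0 = 0
    | ray₃ => v 1 = 0 ∧ v 0 = 0
    | face₁₂ => v 2 = 0 ∧ 0 ≤ v 0 ∧ v 0 ≤ v 1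
    | face₁₃ => v 0 = v 1 + wall n v
    | face₂₃ => v 0 = 0
    | plane => v 0 = wall n v
    | outer => wall n v ≤ v 0 ∧ v 0 ≤ v 1 + wall n v
    | inner => 0 ≤ v 0 ∧ v 0 ≤ wall n v}

/-- A point of each cone that lies on none of its proper faces. -/
noncomputable def Cell.genericVector (n : ℕ) : Cell → NR
  | ray₁ => ![1, 1, 0]
  | ray₂ => ![0, 1, 0]
  | ray₃ => ![0, 0, 1]
  | face₁₂ => ![1, 2, 0]
  | face₁₃ => ![2 * n, n, 1]
  | face₂₃ => ![0, n, 1]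
  | plane => ![n, n, 1]
  | outer => ![3 / 2 * n, n, 1]
  | inner => ![1 / 2 * n, n, 1]

theorem wall_nonneg {n : ℕ} {v : NR} (h1 : 0 ≤ v 1) (h2 : 0 ≤ v 2) : 0 ≤ wall n v :=
  le_min h1 (by positivity)

theorem wall_le (n : ℕ) (v : NR) : wall n v ≤ v 1 := min_le_left _ _

theorem wall_eq_zero {n : ℕ} {v : NR} (h1 : 0 ≤ v 1) (h2 : v 2 = 0) : wall n v = 0 := by
  simp [wall, h1, h2]

theorem Cell.genericVector_mem_cone_iff {n : ℕ} (hn : 1 ≤ n) (a b : Cell) :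
    a.genericVector n ∈ b.cone n ↔ a.features ⊆ b.features := by
  have hn' : (1 : ℝ) ≤ n := by exact_mod_cast hn
  have h0 : (n : ℝ) ≠ 0 := by positivity
  cases a <;> cases b <;>
    simp [cone, genericVector, features, wall, Finset.subset_iff, h0] <;>
    first
      | linarith
      | (intro h; linarith)
      | (constructor <;> linarith)

theorem Cell.cone_subset_of_features_subset {n : ℕ} {a b : Cell}
    (h : a.features ⊆ b.features) : a.cone n ⊆ b.cone n := by
  rintro v ⟨h1, h2, hv⟩
  have w0 := wall_nonneg (n := n) h1 h2
  have w1 := wall_le n v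
  have w2 := wall_eq_zero (n := n) (v := v) h1
  cases a <;> cases b <;>
    first
      | exact absurd h (by decide)
      | exact ⟨h1, h2, hv⟩
      | (refine ⟨h1, h2, ?_⟩
         dsimp only at hv ⊢
         grind)

theorem Cell.cone_subset_iff {n : ℕ} (hn : 1 ≤ n) {a b : Cell} :
    a.cone n ⊆ b.cone n ↔ a.features ⊆ b.features :=
  ⟨fun h => (a.genericVector_mem_cone_iff hn b).1
    (h ((a.genericVector_mem_cone_iff hn a).2 subset_rfl)), cone_subset_of_features_subset⟩

theorem mem_sigma_iff_wall (n : ℕ) (v : NR) :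
    v ∈ sigma n ↔ 0 ≤ v 1 ∧ 0 ≤ v 2 ∧ 0 ≤ v 0 ∧ v 0 ≤ v 1 + wall n v := by
  have : v 0 ≤ v 1 + wall n v ↔ v 0 ≤ v 1 + v 1 ∧ v 0 ≤ v 1 + n * v 2 := by
    rw [wall, ← min_add_add_left, le_min_iff]
  rw [this]
  constructor
  · rintro ⟨h0, h2, h3, h4⟩
    exact ⟨by linarith, h2, h0, by linarith, by linarith⟩
  · rintro ⟨h1, h2, h0, h3, h4⟩
    exact ⟨h0, h2, by linarith, by linarith⟩

theorem vec_ext {u v : NR} (h0 : u 0 = v 0) (h1 : u 1 = v 1) (h2 : u 2 = v 2) : u = v := by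
  ext i; fin_cases i <;> assumption

theorem rho_zero (n : ℕ) : rho 0 = Cell.ray₁.cone n := by
  ext v
  constructor
  · rintro ⟨s, hs, rfl⟩
    simpa [Cell.cone, dPoint] using hs
  · rintro ⟨h1, -, h2, h0⟩
    exact ⟨v 1, h1, vec_ext (by simp [dPoint, h0]) (by simp [dPoint]) (by simp [dPoint, h2])⟩

theorem rho_one (n : ℕ) : rho 1 = Cell.ray₂.cone n := by
  ext v
  constructor
  · rintro ⟨s, hs, rfl⟩
    simpa [Cell.cone, dPoint] using hs
  · rintro ⟨h1, -, h2, h0⟩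
    exact ⟨v 1, h1, vec_ext (by simp [dPoint, h0]) (by simp [dPoint]) (by simp [dPoint, h2])⟩

theorem rho_two (n : ℕ) : rho 2 = Cell.ray₃.cone n := by
  ext v
  constructor
  · rintro ⟨s, hs, rfl⟩
    simpa [Cell.cone, dPoint] using hs
  · rintro ⟨-, h2, h1, h0⟩
    exact ⟨v 2, h2, vec_ext (by simp [dPoint, h0]) (by simp [dPoint, h1]) (by simp [dPoint])⟩

/-! ### Planar cones in the two charts -/

theorem planarCone_comm {d : ℕ} (p q : Fin d → ℝ) : planarCone p q = planarCone q p := by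
  ext v
  constructor <;> rintro ⟨s, t, hs, ht, rfl⟩ <;> exact ⟨t, s, ht, hs, add_comm _ _⟩

theorem unbend_eq (n : ℕ) (v : NR) : unbend n v = ![v 0 + n * v 2 - wall n v, v 1, v 2] := by
  have : max (n * v 2 - v 1) 0 = n * v 2 - wall n v := by
    rw [wall]
    rcases le_total (v 1) (n * v 2) with h | h <;> simp [h]
  change ![v 0 + max (n * v 2 - v 1) 0, v 1, v 2] = _
  rw [this, add_sub_assoc]

/-- The part of the plane `a = b` over the quadrant `b, c ≥ 0`. -/
def diagonalPlane : Set NR := {v | 0 ≤ v 1 ∧ 0 ≤ v 2 ∧ v 0 = v 1}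

theorem planarCone_zero_one (n : ℕ) :
    planarCone (dPoint 0) (dPoint 1) = Cell.face₁₂.cone n := by
  ext v
  constructor
  · rintro ⟨s, t, hs, ht, rfl⟩
    simp [Cell.cone, dPoint, hs, ht]; linarith
  · rintro ⟨-, -, h2, h0, h1⟩
    exact ⟨v 0, v 1 - v 0, h0, by linarith, vec_ext (by simp [dPoint]) (by simp [dPoint])
      (by simp [dPoint, h2])⟩

theorem planarCone_one_two (n : ℕ) :
    planarCone (dPoint 1) (dPoint 2) = Cell.face₂₃.cone n := by
  ext v
  constructor
  · rintro ⟨s, t, hs, ht, rfl⟩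
    simp [Cell.cone, dPoint, hs, ht]
  · rintro ⟨h1, h2, h0⟩
    exact ⟨v 1, v 2, h1, h2, vec_ext (by simp [dPoint, h0]) (by simp [dPoint])
      (by simp [dPoint])⟩

theorem planarCone_zero_two : planarCone (dPoint 0) (dPoint 2) = diagonalPlane := by
  ext v
  constructor
  · rintro ⟨s, t, hs, ht, rfl⟩
    simp [diagonalPlane, dPoint, hs, ht]
  · rintro ⟨h1, h2, h0⟩
    exact ⟨v 1, v 2, h1, h2, vec_ext (by simp [dPoint, h0]) (by simp [dPoint])
      (by simp [dPoint])⟩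

theorem unbend_preimage_zero_one (n : ℕ) :
    unbend n ⁻¹' planarCone (unbend n (dPoint 0)) (unbend n (dPoint 1)) = Cell.face₁₂.cone n := by
  ext v
  simp only [mem_preimage, unbend_eq]
  constructor
  · rintro ⟨s, t, hs, ht, h⟩
    have e0 := congrFun h 0
    have e1 := congrFun h 1
    have e2 := congrFun h 2
    simp [dPoint, wall] at e0 e1 e2
    have h1 : 0 ≤ v 1 := by linarith
    have hw := wall_eq_zero (n := n) h1 e2
    simp only [wall] at hw
    rw [e2, mul_zero] at hw e0
    exact ⟨by linarith, e2.ge, e2, by linarith, by linarith⟩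
  · rintro ⟨h1, -, h2, h0, h3⟩
    have hw := wall_eq_zero (n := n) h1 h2
    refine ⟨v 0, v 1 - v 0, h0, by linarith, vec_ext ?_ ?_ ?_⟩ <;>
      simp [dPoint, h2, wall, h1]

theorem unbend_preimage_zero_two (n : ℕ) :
    unbend n ⁻¹' planarCone (unbend n (dPoint 0)) (unbend n (dPoint 2)) = Cell.face₁₃.cone n := by
  ext v
  simp only [mem_preimage, unbend_eq]
  constructor
  · rintro ⟨s, t, hs, ht, h⟩
    have e0 := congrFun h 0
    have e1 := congrFun h 1
    have e2 := congrFun h 2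
    simp [dPoint, wall] at e0 e1 e2
    refine ⟨by linarith, by linarith, ?_⟩
    simp only [wall]
    rw [e2] at e0 ⊢
    linarith
  · rintro ⟨h1, h2, h0⟩
    refine ⟨v 1, v 2, h1, h2, vec_ext ?_ ?_ ?_⟩ <;> simp [dPoint, wall, h0]
    ring

theorem unbend_preimage_one_two (n : ℕ) :
    unbend n ⁻¹' planarCone (unbend n (dPoint 1)) (unbend n (dPoint 2)) = Cell.plane.cone n := by
  ext v
  simp only [mem_preimage, unbend_eq]
  constructor
  · rintro ⟨s, t, hs, ht, h⟩
    have e0 := congrFun h 0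
    have e1 := congrFun h 1
    have e2 := congrFun h 2
    simp [dPoint, wall] at e0 e1 e2
    refine ⟨by linarith, by linarith, ?_⟩
    simp only [wall]
    rw [e2] at e0 ⊢
    linarith
  · rintro ⟨h1, h2, h0⟩
    refine ⟨v 1, v 2, h1, h2, vec_ext ?_ ?_ ?_⟩ <;> simp [dPoint, wall, h0]
    ring

theorem rightPlane_eq (n : ℕ) : rightPlane n = diagonalPlane := by
  ext v
  constructor
  · rintro (⟨s, t, hs, ht, rfl⟩ | ⟨s, t, hs, ht, rfl⟩) <;>
      simp [diagonalPlane, dPoint] <;> constructor <;> positivity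
  · rintro ⟨h1, h2, h0⟩
    rcases le_total (n * v 2) (v 1) with h | h
    · left
      refine ⟨v 1 - n * v 2, v 2, by linarith, h2, vec_ext ?_ ?_ ?_⟩ <;>
        simp [dPoint, h0] <;> ring
    · right
      rcases Nat.eq_zero_or_pos n with rfl | hn
      · have : v 1 = 0 := by simp at h; linarith
        refine ⟨0, v 2, le_rfl, h2, vec_ext ?_ ?_ ?_⟩ <;> simp [dPoint, h0, this]
      · have hn' : (0 : ℝ) < n := by exact_mod_cast hn
        have : v 1 / n ≤ v 2 := by rw [div_le_iff₀ hn']; linarith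
        refine ⟨v 1 / n, v 2 - v 1 / n, by positivity, by linarith, vec_ext ?_ ?_ ?_⟩ <;>
          simp [dPoint, h0] <;> field_simp

theorem leftPlane_eq (n : ℕ) : leftPlane n = Cell.plane.cone n := by
  ext v
  constructor
  · rintro (⟨s, t, hs, ht, rfl⟩ | ⟨s, t, hs, ht, rfl⟩)
    · have : (0 : ℝ) ≤ t * n := by positivity
      simp [Cell.cone, dPoint, wall, ht]
      rw [min_eq_right (by linarith)]
      constructor
      · positivity
      · ring
    · have : (0 : ℝ) ≤ n * t := by positivity
      simp [Cell.cone, dPoint, wall]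
      exact ⟨by positivity, by positivity, by linarith⟩
  · rintro ⟨h1, h2, h0⟩
    dsimp only [wall] at h0
    rcases le_total (n * v 2) (v 1) with h | h
    · left
      rw [min_eq_right h] at h0
      refine ⟨v 1 - n * v 2, v 2, by linarith, h2, vec_ext ?_ ?_ ?_⟩ <;>
        simp [dPoint, h0] <;> ring
    · right
      rw [min_eq_left h] at h0
      rcases Nat.eq_zero_or_pos n with rfl | hn
      · have : v 1 = 0 := by simp at h; linarith
        refine ⟨0, v 2, le_rfl, h2, vec_ext ?_ ?_ ?_⟩ <;> simp [dPoint, h0, this]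
      · have hn' : (0 : ℝ) < n := by exact_mod_cast hn
        have : v 1 / n ≤ v 2 := by rw [div_le_iff₀ hn']; linarith
        refine ⟨v 1 / n, v 2 - v 1 / n, by positivity, by linarith, vec_ext ?_ ?_ ?_⟩ <;>
          simp [dPoint, h0] <;> field_simp

/-! ### Straight sectors of `σ` -/

theorem mem_closure_of_path {s : Set NR} (γ : ℝ → NR) (hγ : Continuous γ)
    (h : ∀ ε, 0 < ε → γ ε ∈ s) : γ 0 ∈ closure s :=
  mem_closure_of_tendsto ((hγ.tendsto 0).mono_left nhdsWithin_le_nhds)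
    (eventually_nhdsWithin_of_forall h : ∀ᶠ ε in 𝓝[>] (0 : ℝ), γ ε ∈ s)

/-- A closed set that can be moved into itself by increasing `b` along a continuous path is the
closure of its part away from the singular line: such a path leaves the plane `b = nc` at once. -/
theorem closure_diff_singularLine {n : ℕ} {W : Set NR} (hW : IsClosed W) (f : NR → ℝ → ℝ)
    (hf : ∀ v, Continuous (f v)) (h0 : ∀ v ∈ W, f v 0 = v 0)
    (hmem : ∀ v ∈ W, ∀ ε, 0 < ε → ![f v ε, v 1 + ε, v 2] ∈ W) :
    closure (W \ singularLine n) = W := by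
  refine Subset.antisymm ((closure_mono sdiff_subset).trans hW.closure_eq.le) fun v hv => ?_
  by_cases hl : v ∈ singularLine n
  · rw [mem_singularLine_iff] at hl
    have key := mem_closure_of_path (s := W \ singularLine n)
      (fun ε => ![f v ε, v 1 + ε, v 2]) ?_ fun ε hε => ⟨hmem v hv ε hε, ?_⟩
    · convert key using 1
      exact vec_ext (by simp [h0 v hv]) (by simp) (by simp)
    · refine continuous_pi fun i => ?_
      have := hf v
      fin_cases i <;> simp <;> fun_prop
    · rw [mem_singularLine_iff]
      simp [hl.1, hε.ne']
  · exact subset_closure ⟨hv, hl⟩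

theorem Cell.isClosed_cone (n : ℕ) (k : Cell) : IsClosed (k.cone n) := by
  have hw := continuous_wall n
  cases k <;> simp only [cone, ofPred_and] <;>
    repeat' first
      | apply IsClosed.inter
      | exact isClosed_le (by fun_prop) (by fun_prop)
      | exact isClosed_eq (by fun_prop) (by fun_prop)

theorem isClosed_diagonalPlane : IsClosed diagonalPlane := by
  simp only [diagonalPlane, ofPred_and]
  exact (isClosed_le (by fun_prop) (by fun_prop)).inter
    ((isClosed_le (by fun_prop) (by fun_prop)).inter (isClosed_eq (by fun_prop) (by fun_prop)))

theorem closure_cone_diff_singularLine (n : ℕ) {k : Cell}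
    (hk : k = .face₁₂ ∨ k = .face₁₃ ∨ k = .face₂₃ ∨ k = .plane) :
    closure (k.cone n \ singularLine n) = k.cone n := by
  rcases hk with rfl | rfl | rfl | rfl
  · refine closure_diff_singularLine (Cell.isClosed_cone n _) (fun v _ => v 0)
      (fun v => by fun_prop) (fun v _ => rfl) fun v hv ε hε => ?_
    obtain ⟨h1, h2, h3, h4, h5⟩ := hv
    exact ⟨by simp; linarith, h2, h3, h4, by simp; linarith⟩
  · refine closure_diff_singularLine (Cell.isClosed_cone n _)
      (fun v ε => (v 1 + ε) + min (v 1 + ε) (n * v 2))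
      (fun v => by fun_prop) (fun v hv => ?_) fun v hv ε hε => ?_
    · simpa [wall] using hv.2.2.symm
    · exact ⟨by simp; linarith [hv.1], hv.2.1, by simp [wall]⟩
  · refine closure_diff_singularLine (Cell.isClosed_cone n _) (fun v ε => 0)
      (fun v => by fun_prop) (fun v hv => hv.2.2.symm) fun v hv ε hε => ?_
    exact ⟨by simp; linarith [hv.1], hv.2.1, rfl⟩
  · refine closure_diff_singularLine (Cell.isClosed_cone n _)
      (fun v ε => min (v 1 + ε) (n * v 2))
      (fun v => by fun_prop) (fun v hv => ?_) fun v hv ε hε => ?_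
    · simpa [wall] using hv.2.2.symm
    · exact ⟨by simp; linarith [hv.1], hv.2.1, by simp [wall]⟩

theorem closure_diagonalPlane_diff_singularLine (n : ℕ) :
    closure (diagonalPlane \ singularLine n) = diagonalPlane := by
  refine closure_diff_singularLine isClosed_diagonalPlane (fun v ε => v 1 + ε)
    (fun v => by fun_prop) (fun v hv => ?_) fun v hv ε hε => ?_
  · simpa using hv.2.2.symm
  · exact ⟨by simp; linarith [hv.1], hv.2.1, by simp⟩

theorem isStraightSector_iff {n : ℕ} (hn : 1 ≤ n) (i j : Fin 3) (W : Set NR) :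
    (tropU n).IsStraightSector (dPoint i) (dPoint j) W ↔
      closure (W \ singularLine n) = W ∧
        ((W \ singularLine n ⊆ (closedHalfPlanePos n)ᶜ ∧ W = planarCone (dPoint i) (dPoint j)) ∨
        (W \ singularLine n ⊆ (closedHalfPlaneNeg n)ᶜ ∧
          W = unbend n ⁻¹' planarCone (unbend n (dPoint i)) (unbend n (dPoint j)))) := by
  have hn' : (n : ℝ) ≠ 0 := by positivity
  have hd : ∀ i, dPoint i ∈ (closedHalfPlanePos n)ᶜ ∧ dPoint i ∈ (closedHalfPlaneNeg n)ᶜ := by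
    intro i
    fin_cases i <;> simp [dPoint, closedHalfPlanePos, closedHalfPlaneNeg, hn'.symm]
  unfold IntegralAffineStructure.IsStraightSector
  refine and_congr_right fun hcl => ?_
  change (∃ e ∈ ({chartNeg n, chartPos n} : Set _), _) ↔ _
  simp only [mem_insert_iff, mem_singleton_iff, exists_eq_or_imp, exists_eq_left, chartNeg_source,
    chartPos_source, hd, true_and]
  have e1 : chartNeg n '' (W \ singularLine n) = W \ singularLine n := by
    exact image_id _
  have e2 : closure (chartPos n '' (W \ singularLine n)) = unbend n '' W := by
    conv_rhs => rw [← hcl, (unbend n).image_closure]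
    rfl
  rw [e1, e2, hcl]
  refine or_congr Iff.rfl (and_congr_right fun _ => ?_)
  simp only [chartPos_apply]
  constructor
  · intro h
    rw [← h, (unbend n).injective.preimage_image]
  · intro h
    conv_lhs => rw [h]
    exact (unbend n).surjective.image_preimage _

/-- The five straight planar sectors in `σ`: the three faces and the two subdividing planes. -/
theorem isSectorOfSigma_iff {n : ℕ} (hn : 1 ≤ n) (W : Set NR) :
    IsSectorOfSigma n W ↔ W = Cell.face₁₂.cone n ∨ W = Cell.face₁₃.cone n ∨
      W = Cell.face₂₃.cone n ∨ W = Cell.plane.cone n ∨ W = diagonalPlane := by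
  have hn' : (1 : ℝ) ≤ n := by exact_mod_cast hn
  constructor
  · rintro ⟨-, i, j, hij, h⟩
    rw [isStraightSector_iff hn] at h
    obtain ⟨-, ⟨-, h⟩ | ⟨-, h⟩⟩ := h
    · fin_cases i <;> fin_cases j <;> simp only [Fin.zero_eta, Fin.mk_one, Fin.reduceFinMk,
        ne_eq, not_true_eq_false] at hij h <;>
        first
          | (rw [planarCone_zero_one n] at h; simp [h])
          | (rw [planarCone_one_two n] at h; simp [h])
          | (rw [planarCone_zero_two] at h; simp [h])
          | (rw [planarCone_comm, planarCone_zero_one n] at h; simp [h])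
          | (rw [planarCone_comm, planarCone_one_two n] at h; simp [h])
          | (rw [planarCone_comm, planarCone_zero_two] at h; simp [h])
    · fin_cases i <;> fin_cases j <;> simp only [Fin.zero_eta, Fin.mk_one, Fin.reduceFinMk,
        ne_eq, not_true_eq_false] at hij h <;>
        first
          | (rw [unbend_preimage_zero_one n] at h; simp [h])
          | (rw [unbend_preimage_one_two n] at h; simp [h])
          | (rw [unbend_preimage_zero_two] at h; simp [h])
          | (rw [planarCone_comm, unbend_preimage_zero_one n] at h; simp [h])
          | (rw [planarCone_comm, unbend_preimage_one_two n] at h; simp [h])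
          | (rw [planarCone_comm, unbend_preimage_zero_two] at h; simp [h])
  · rintro (rfl | rfl | rfl | rfl | rfl)
    · refine ⟨?_, 0, 1, by decide, (isStraightSector_iff hn 0 1 _).2
        ⟨closure_cone_diff_singularLine n (by simp), Or.inl ⟨?_, (planarCone_zero_one n).symm⟩⟩⟩
      · rintro v ⟨h1, h2, -, h0, h3⟩
        exact (mem_sigma_iff_wall n v).2 ⟨h1, h2, h0, by linarith [wall_nonneg (n := n) h1 h2]⟩
      · rintro v ⟨⟨h1, h2, h3, h0, h4⟩, hl⟩ ⟨h5, h6⟩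
        rw [h3, mul_zero] at h5 h6
        exact hl ((mem_singularLine_iff n v).2 ⟨by rw [h3, mul_zero, h5], by
          rw [h3, mul_zero]; linarith⟩)
    · refine ⟨?_, 0, 2, by decide, (isStraightSector_iff hn 0 2 _).2
        ⟨closure_cone_diff_singularLine n (by simp), Or.inr ⟨?_,
          (unbend_preimage_zero_two n).symm⟩⟩⟩
      · rintro v ⟨h1, h2, h0⟩
        exact (mem_sigma_iff_wall n v).2 ⟨h1, h2, by linarith [wall_nonneg (n := n) h1 h2], h0.le⟩
      · rintro v ⟨⟨h1, h2, h0⟩, hl⟩ ⟨h5, h6⟩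
        simp only [wall, h5, min_self] at h0
        exact hl ((mem_singularLine_iff n v).2 ⟨h5, by linarith⟩)
    · refine ⟨?_, 1, 2, by decide, (isStraightSector_iff hn 1 2 _).2
        ⟨closure_cone_diff_singularLine n (by simp), Or.inl ⟨?_, (planarCone_one_two n).symm⟩⟩⟩
      · rintro v ⟨h1, h2, h0⟩
        exact (mem_sigma_iff_wall n v).2 ⟨h1, h2, h0.ge, by linarith [wall_nonneg (n := n) h1 h2]⟩
      · rintro v ⟨⟨h1, h2, h0⟩, hl⟩ ⟨h5, h6⟩
        exact hl ((mem_singularLine_iff n v).2 ⟨h5, by linarith⟩)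
    · refine ⟨?_, 1, 2, by decide, (isStraightSector_iff hn 1 2 _).2
        ⟨closure_cone_diff_singularLine n (by simp), Or.inr ⟨?_,
          (unbend_preimage_one_two n).symm⟩⟩⟩
      · rintro v ⟨h1, h2, h0⟩
        have := wall_nonneg (n := n) h1 h2
        exact (mem_sigma_iff_wall n v).2 ⟨h1, h2, by linarith, by linarith⟩
      · rintro v ⟨⟨h1, h2, h0⟩, hl⟩ ⟨h5, h6⟩
        simp only [wall, h5, min_self] at h0
        exact hl ((mem_singularLine_iff n v).2 ⟨h5, h0⟩)
    · refine ⟨?_, 0, 2, by decide, (isStraightSector_iff hn 0 2 _).2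
        ⟨closure_diagonalPlane_diff_singularLine n, Or.inl ⟨?_, planarCone_zero_two.symm⟩⟩⟩
      · rintro v ⟨h1, h2, h0⟩
        exact (mem_sigma_iff_wall n v).2 ⟨h1, h2, by linarith,
          by linarith [wall_nonneg (n := n) h1 h2]⟩
      · rintro v ⟨⟨h1, h2, h0⟩, hl⟩ ⟨h5, h6⟩
        exact hl ((mem_singularLine_iff n v).2 ⟨h5, by linarith⟩)

theorem exists_add_smul_mem_of_mem_interior {s : Set NR} {v : NR} (hv : v ∈ interior s) (w : NR) :
    ∃ ε : ℝ, 0 < ε ∧ v + ε • w ∈ s := by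
  have hc : ContinuousAt (fun ε : ℝ => v + ε • w) 0 := by fun_prop
  have h : ∀ᶠ ε in 𝓝[>] (0 : ℝ), v + ε • w ∈ s :=
    (hc.eventually (by simpa using mem_interior_iff_mem_nhds.1 hv)).filter_mono nhdsWithin_le_nhds
  obtain ⟨ε, h1, h2⟩ := (h.and self_mem_nhdsWithin).exists
  exact ⟨ε, h2, h1⟩

theorem disjoint_face_interior_sigma (n : ℕ) {k : Cell}
    (hk : k = .face₁₂ ∨ k = .face₁₃ ∨ k = .face₂₃) :
    Disjoint (k.cone n) (interior (sigma n)) := by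
  rw [Set.disjoint_left]
  rintro v hv hi
  rcases hk with rfl | rfl | rfl
  · obtain ⟨ε, hε, h⟩ := exists_add_smul_mem_of_mem_interior hi ![0, 0, -1]
    have h1 := hv.2.2.1
    have h2 := h.2.1
    simp at h2
    linarith
  · obtain ⟨ε, hε, h⟩ := exists_add_smul_mem_of_mem_interior hi ![1, 0, 0]
    have h1 := hv.2.2
    have h2 := ((mem_sigma_iff_wall n _).1 h).2.2.2
    simp [wall] at h2
    simp only [wall] at h1
    linarith
  · obtain ⟨ε, hε, h⟩ := exists_add_smul_mem_of_mem_interior hi ![-1, 0, 0]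
    have h1 := hv.2.2
    have h2 := h.1
    simp at h2
    linarith

theorem singular_vector_mem_interior_sigma {n : ℕ} (hn : 1 ≤ n) :
    ![(n : ℝ), n, 1] ∈ interior (sigma n) := by
  have hn' : (0 : ℝ) < n := by exact_mod_cast hn
  have ho : IsOpen {v : NR | 0 < v 0 ∧ 0 < v 2 ∧ v 0 - 2 * v 1 < 0 ∧ v 0 - v 1 - n * v 2 < 0} := by
    simp only [ofPred_and]
    repeat' first
      | apply IsOpen.inter
      | exact isOpen_lt (by fun_prop) (by fun_prop)
  refine interior_maximal (fun v hv => ?_) ho ?_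
  · exact ⟨hv.1.le, hv.2.1.le, hv.2.2.1.le, hv.2.2.2.le⟩
  · simp [hn']

theorem plane_inter_interior_nonempty {n : ℕ} (hn : 1 ≤ n) :
    (Cell.plane.cone n ∩ interior (sigma n)).Nonempty :=
  ⟨_, by simp [Cell.cone, wall], singular_vector_mem_interior_sigma hn⟩

theorem diagonalPlane_inter_interior_nonempty {n : ℕ} (hn : 1 ≤ n) :
    (diagonalPlane ∩ interior (sigma n)).Nonempty :=
  ⟨_, by simp [diagonalPlane], singular_vector_mem_interior_sigma hn⟩

theorem isFaceOfSigma_iff {n : ℕ} (hn : 1 ≤ n) (W : Set NR) :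
    IsFaceOfSigma n W ↔ W = Cell.face₁₂.cone n ∨ W = Cell.face₁₃.cone n ∨
      W = Cell.face₂₃.cone n := by
  rw [IsFaceOfSigma, isSectorOfSigma_iff hn]
  constructor
  · rintro ⟨h | h | h | h | h, hd⟩
    · exact Or.inl h
    · exact Or.inr (Or.inl h)
    · exact Or.inr (Or.inr h)
    · exact absurd hd (not_disjoint_iff_nonempty_inter.2 (h ▸ plane_inter_interior_nonempty hn))
    · exact absurd hd
        (not_disjoint_iff_nonempty_inter.2 (h ▸ diagonalPlane_inter_interior_nonempty hn))
  · rintro (rfl | rfl | rfl) <;>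
      exact ⟨by simp, disjoint_face_interior_sigma n (by simp)⟩

theorem isSubdividingPlane_iff {n : ℕ} (hn : 1 ≤ n) (W : Set NR) :
    IsSubdividingPlane n W ↔ W = leftPlane n ∨ W = rightPlane n := by
  rw [IsSubdividingPlane, isSectorOfSigma_iff hn, leftPlane_eq, rightPlane_eq]
  have hf : ∀ k : Cell, k = .face₁₂ ∨ k = .face₁₃ ∨ k = .face₂₃ →
      ¬(k.cone n ∩ interior (sigma n)).Nonempty := fun k hk =>
    fun h => not_disjoint_iff_nonempty_inter.2 h (disjoint_face_interior_sigma n hk)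
  constructor
  · rintro ⟨h | h | h | h | h, hd⟩
    · exact absurd (h ▸ hd) (hf _ (by simp))
    · exact absurd (h ▸ hd) (hf _ (by simp))
    · exact absurd (h ▸ hd) (hf _ (by simp))
    · exact Or.inl h
    · exact Or.inr h
  · rintro (rfl | rfl)
    · exact ⟨by simp, plane_inter_interior_nonempty hn⟩
    · exact ⟨by simp, diagonalPlane_inter_interior_nonempty hn⟩

theorem leftPlane_ne_rightPlane (n : ℕ) : leftPlane n ≠ rightPlane n := by
  rw [leftPlane_eq, rightPlane_eq]
  intro h
  have : (![0, 1, 0] : NR) ∈ diagonalPlane := h ▸ (by simp [Cell.cone, wall])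
  simp [diagonalPlane] at this

/-! ### The three-dimensional cones of the subdivision -/

theorem sigma_diff_plane (n : ℕ) : sigma n \ Cell.plane.cone n =
    {v ∈ sigma n | wall n v < v 0} ∪ {v ∈ sigma n | v 0 < wall n v} := by
  ext v
  have : v ∈ sigma n → (v ∈ Cell.plane.cone n ↔ v 0 = wall n v) := fun h => by
    rw [mem_sigma_iff_wall] at h
    exact ⟨fun h' => h'.2.2, fun h' => ⟨h.1, h.2.1, h'⟩⟩
  constructor
  · rintro ⟨hs, h⟩
    rw [this hs] at h
    rcases lt_or_gt_of_ne h with h | h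
    · exact Or.inr ⟨hs, h⟩
    · exact Or.inl ⟨hs, h⟩
  · rintro (⟨hs, h⟩ | ⟨hs, h⟩)
    · exact ⟨hs, fun h' => h.ne' ((this hs).1 h')⟩
    · exact ⟨hs, fun h' => h.ne ((this hs).1 h')⟩

/-- The part of `σ` beyond the subdividing plane becomes convex in the chart that develops through
`H⁺`. -/
theorem isPreconnected_outer (n : ℕ) : IsPreconnected {v ∈ sigma n | wall n v < v 0} := by
  have : {v ∈ sigma n | wall n v < v 0} = unbend n ⁻¹'
      {v | 0 ≤ v 1 ∧ 0 ≤ v 2 ∧ n * v 2 < v 0 ∧ v 0 ≤ v 1 + n * v 2} := by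
    ext v
    simp only [mem_ofPred_eq, mem_sigma_iff_wall, mem_preimage, unbend_eq, Matrix.cons_val_zero,
      Matrix.cons_val_one, Matrix.cons_val]
    constructor
    · rintro ⟨⟨h1, h2, h0, h3⟩, h4⟩
      exact ⟨h1, h2, by linarith, by linarith⟩
    · rintro ⟨h1, h2, h0, h3⟩
      have := wall_nonneg (n := n) h1 h2
      exact ⟨⟨h1, h2, by linarith, by linarith⟩, by linarith⟩
  rw [this, (unbend n).isPreconnected_preimage]
  refine Convex.isPreconnected fun u hu v hv s t hs ht hst => ?_
  obtain ⟨u1, u2, u3, u4⟩ := hu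
  obtain ⟨v1, v2, v3, v4⟩ := hv
  refine ⟨?_, ?_, ?_, ?_⟩ <;> simp only [Pi.add_apply, Pi.smul_apply, smul_eq_mul]
  · positivity
  · positivity
  · rcases hs.eq_or_lt with rfl | hs'
    · have : t = 1 := by linarith
      subst this; linarith
    · nlinarith [mul_lt_mul_of_pos_left u3 hs', mul_le_mul_of_nonneg_left v3.le ht]
  · nlinarith [mul_le_mul_of_nonneg_left u4 hs, mul_le_mul_of_nonneg_left v4 ht]

theorem isPreconnected_inner (n : ℕ) : IsPreconnected {v ∈ sigma n | v 0 < wall n v} := by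
  have : {v ∈ sigma n | v 0 < wall n v} =
      {v : NR | 0 ≤ v 1 ∧ 0 ≤ v 2 ∧ 0 ≤ v 0 ∧ v 0 < v 1 ∧ v 0 < n * v 2} := by
    ext v
    simp only [mem_ofPred_eq, mem_sigma_iff_wall]
    constructor
    · rintro ⟨⟨h1, h2, h0, h3⟩, h4⟩
      exact ⟨h1, h2, h0, lt_min_iff.1 h4⟩
    · rintro ⟨h1, h2, h0, h3⟩
      have h4 : v 0 < wall n v := lt_min_iff.2 h3
      exact ⟨⟨h1, h2, h0, by linarith⟩, h4⟩
  rw [this]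
  refine Convex.isPreconnected fun u hu v hv s t hs ht hst => ?_
  obtain ⟨u1, u2, u0, u3, u4⟩ := hu
  obtain ⟨v1, v2, v0, v3, v4⟩ := hv
  refine ⟨?_, ?_, ?_, ?_, ?_⟩ <;> simp only [Pi.add_apply, Pi.smul_apply, smul_eq_mul]
  · positivity
  · positivity
  · positivity
  all_goals
    rcases hs.eq_or_lt with rfl | hs'
    · have : t = 1 := by linarith
      subst this; linarith
  · nlinarith [mul_lt_mul_of_pos_left u3 hs', mul_le_mul_of_nonneg_left v3.le ht]
  · nlinarith [mul_lt_mul_of_pos_left u4 hs', mul_le_mul_of_nonneg_left v4.le ht]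

theorem closure_outer (n : ℕ) :
    closure {v ∈ sigma n | wall n v < v 0} = Cell.outer.cone n := by
  have hw := continuous_wall n
  apply Subset.antisymm
  · refine closure_minimal ?_ (Cell.isClosed_cone n _)
    rintro v ⟨hs, h⟩
    obtain ⟨h1, h2, h0, h3⟩ := (mem_sigma_iff_wall n v).1 hs
    exact ⟨h1, h2, h.le, h3⟩
  · rintro v ⟨h1, h2, h3, h4⟩
    -- Increase `b` and the height over the wall by the same amount `ε`: the bounds persist and the
    -- lower one becomes strict.
    have key := mem_closure_of_path (s := {v ∈ sigma n | wall n v < v 0})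
      (fun ε => ![min (v 1 + ε) (n * v 2) + (v 0 - wall n v) + ε, v 1 + ε, v 2]) ?_ fun ε hε => ?_
    · convert key using 1
      exact vec_ext (by simp [wall]) (by simp) (by simp)
    · refine continuous_pi fun i => ?_
      fin_cases i <;> simp <;> fun_prop
    · have h5 : 0 ≤ min (v 1 + ε) (n * v 2) := le_min (by linarith) (by positivity)
      refine ⟨(mem_sigma_iff_wall n _).2 ⟨?_, h2, ?_, ?_⟩, ?_⟩ <;>
        simp only [wall, Matrix.cons_val_zero, Matrix.cons_val_one, Matrix.cons_val] at h3 h4 ⊢ <;>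
        linarith

theorem closure_inner {n : ℕ} (hn : 1 ≤ n) :
    closure {v ∈ sigma n | v 0 < wall n v} = Cell.inner.cone n := by
  have hn' : (0 : ℝ) < n := by exact_mod_cast hn
  apply Subset.antisymm
  · refine closure_minimal ?_ (Cell.isClosed_cone n _)
    rintro v ⟨hs, h⟩
    obtain ⟨h1, h2, h0, h3⟩ := (mem_sigma_iff_wall n v).1 hs
    exact ⟨h1, h2, h0, h.le⟩
  · rintro v ⟨h1, h2, h3, h4⟩
    -- Increasing both `b` and `c` raises the wall above `v`.
    have key := mem_closure_of_path (s := {v ∈ sigma n | v 0 < wall n v})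
      (fun ε => ![v 0, v 1 + ε, v 2 + ε]) ?_ fun ε hε => ?_
    · convert key using 1
      exact vec_ext (by simp) (by simp) (by simp)
    · refine continuous_pi fun i => ?_
      fin_cases i <;> simp <;> fun_prop
    · have h5 : v 0 < wall n ![v 0, v 1 + ε, v 2 + ε] := by
        obtain ⟨h6, h7⟩ := le_min_iff.1 h4
        have := mul_pos hn' hε
        refine lt_min ?_ ?_ <;> simp <;> linarith
      refine ⟨(mem_sigma_iff_wall n _).2 ⟨?_, ?_, h3, ?_⟩, h5⟩
      · simp; linarith
      · simp; linarith
      · simp only [Matrix.cons_val_zero, Matrix.cons_val_one]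
        linarith

theorem connectedComponentIn_eq_of_union {X : Type*} [TopologicalSpace X] {A B U V : Set X}
    (hU : IsOpen U) (hV : IsOpen V) (hUV : Disjoint U V) (hA : A ⊆ U) (hB : B ⊆ V)
    (hc : IsPreconnected A) {v : X} (hv : v ∈ A) : connectedComponentIn (A ∪ B) v = A := by
  refine Subset.antisymm (fun w hw => ?_)
    (hc.subset_connectedComponentIn hv subset_union_left)
  have hs := connectedComponentIn_subset (A ∪ B) v
  have hl := isPreconnected_connectedComponentIn.subset_left_of_subset_union hU hV hUV
    (hs.trans (union_subset_union hA hB))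
    ⟨v, mem_connectedComponentIn (Or.inl hv), hA hv⟩
  exact (hs hw).resolve_right fun h => hUV.le_bot ⟨hl hw, hB h⟩

theorem closures_of_components {n : ℕ} (hn : 1 ≤ n) :
    {τ | ∃ v ∈ sigma n \ Cell.plane.cone n,
      τ = closure (connectedComponentIn (sigma n \ Cell.plane.cone n) v)} =
    {Cell.outer.cone n, Cell.inner.cone n} := by
  have hn' : (0 : ℝ) < n := by exact_mod_cast hn
  have hw := continuous_wall n
  have hU : IsOpen {v : NR | wall n v < v 0} := isOpen_lt (by fun_prop) (by fun_prop)
  have hV : IsOpen {v : NR | v 0 < wall n v} := isOpen_lt (by fun_prop) (by fun_prop)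
  have hd : Disjoint {v : NR | wall n v < v 0} {v : NR | v 0 < wall n v} :=
    Set.disjoint_left.2 fun v (h : wall n v < v 0) h' => lt_asymm h h'
  have e1 : ∀ v ∈ {v ∈ sigma n | wall n v < v 0},
      closure (connectedComponentIn (sigma n \ Cell.plane.cone n) v) = Cell.outer.cone n := by
    intro v hv
    rw [sigma_diff_plane, connectedComponentIn_eq_of_union hU hV hd (fun _ h => h.2)
      (fun _ h => h.2) (isPreconnected_outer n) hv, closure_outer]
  have e2 : ∀ v ∈ {v ∈ sigma n | v 0 < wall n v},
      closure (connectedComponentIn (sigma n \ Cell.plane.cone n) v) = Cell.inner.cone n := by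
    intro v hv
    rw [sigma_diff_plane, union_comm, connectedComponentIn_eq_of_union hV hU hd.symm
      (fun _ h => h.2) (fun _ h => h.2) (isPreconnected_inner n) hv, closure_inner hn]
  apply Subset.antisymm
  · rintro τ ⟨v, hv, rfl⟩
    rw [sigma_diff_plane] at hv
    rcases hv with hv | hv
    · exact Or.inl (e1 v hv)
    · exact Or.inr (e2 v hv)
  · rintro τ (rfl | rfl)
    · have hv : ![1, 1, 0] ∈ {v ∈ sigma n | wall n v < v 0} := by
        refine ⟨(mem_sigma_iff_wall n _).2 ?_, ?_⟩ <;> simp [wall]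
      exact ⟨_, sigma_diff_plane n ▸ Or.inl hv, (e1 _ hv).symm⟩
    · have hv : (![0, (n : ℝ), 1] : NR) ∈ {v ∈ sigma n | v 0 < wall n v} := by
        refine ⟨(mem_sigma_iff_wall n _).2 ?_, ?_⟩ <;> simp [wall]
        exact hn
      exact ⟨_, sigma_diff_plane n ▸ Or.inr hv, (e2 _ hv).symm⟩

theorem subdivisionCones_leftPlane {n : ℕ} (hn : 1 ≤ n) :
    subdivisionCones n (leftPlane n) = range (Cell.cone n) := by
  have hr : range rho = {Cell.ray₁.cone n, Cell.ray₂.cone n, Cell.ray₃.cone n} := by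
    ext τ
    simp only [mem_range, Fin.exists_fin_succ, mem_insert_iff,
      mem_singleton_iff, ← rho_zero, ← rho_one, ← rho_two]
    simp [eq_comm]
  rw [subdivisionCones, leftPlane_eq, closures_of_components hn, hr]
  ext τ
  simp only [isFaceOfSigma_iff hn, mem_union, mem_insert_iff, mem_singleton_iff, mem_ofPred_eq,
    mem_range]
  constructor
  · rintro ((((rfl | rfl | rfl) | rfl | rfl | rfl) | rfl) | rfl | rfl) <;> exact ⟨_, rfl⟩
  · rintro ⟨k, rfl⟩
    cases k <;> simp

/-! ### The reflection of `σ` that exchanges the two subdividing planes -/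

/-- The involution `(a, b, c) ↦ (b + min (b, nc) - a, b, c)`. It is an isomorphism of integral
affine structures that exchanges the two charts up to linear maps, preserves `σ` and `ρ₃`, and
exchanges `ρ₁` with `ρ₂` and the two subdividing planes. -/
noncomputable def reflection (n : ℕ) : NR ≃ₜ NR where
  toFun v := ![v 1 + wall n v - v 0, v 1, v 2]
  invFun v := ![v 1 + wall n v - v 0, v 1, v 2]
  left_inv v := vec_ext (by simp [wall]) rfl rfl
  right_inv v := vec_ext (by simp [wall]) rfl rfl
  continuous_toFun := by
    have := continuous_wall n
    refine continuous_pi fun i => ?_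
    fin_cases i <;> simp <;> fun_prop
  continuous_invFun := by
    have := continuous_wall n
    refine continuous_pi fun i => ?_
    fin_cases i <;> simp <;> fun_prop

theorem reflection_apply (n : ℕ) (v : NR) :
    reflection n v = ![v 1 + wall n v - v 0, v 1, v 2] := rfl

theorem reflection_reflection (n : ℕ) (v : NR) : reflection n (reflection n v) = v :=
  (reflection n).symm_apply_apply v

theorem wall_reflection (n : ℕ) (v : NR) :
    wall n ![v 1 + wall n v - v 0, v 1, v 2] = wall n v := by simp [wall]

theorem preimage_reflection_sigma (n : ℕ) : reflection n ⁻¹' sigma n = sigma n := by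
  ext v
  simp only [mem_preimage, reflection_apply, mem_sigma_iff_wall, wall_reflection,
    Matrix.cons_val_zero, Matrix.cons_val_one, Matrix.cons_val]
  constructor <;> rintro ⟨h1, h2, h3, h4⟩ <;> exact ⟨h1, h2, by linarith, by linarith⟩

theorem preimage_reflection_plane (n : ℕ) :
    reflection n ⁻¹' Cell.plane.cone n = diagonalPlane := by
  ext v
  simp only [mem_preimage, reflection_apply, Cell.cone, diagonalPlane, wall_reflection,
    Matrix.cons_val_zero, Matrix.cons_val_one, Matrix.cons_val, mem_ofPred_eq]
  constructor <;> rintro ⟨h1, h2, h3⟩ <;> exact ⟨h1, h2, by linarith⟩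

/-- The permutation of the rays induced by the reflection. -/
def swapRays : Equiv.Perm (Fin 3) := Equiv.swap 0 1

theorem preimage_reflection_rho (n : ℕ) (i : Fin 3) :
    reflection n ⁻¹' rho i = rho (swapRays i) := by
  have h : ∀ (v : NR) (i : Fin 3), v ∈ rho i → reflection n v ∈ rho (swapRays i) := by
    rintro v i ⟨s, hs, rfl⟩
    refine ⟨s, hs, vec_ext ?_ ?_ ?_⟩ <;> fin_cases i <;>
      simp [reflection_apply, dPoint, swapRays, wall, hs, Equiv.swap_apply_def, mul_nonneg]
  ext v
  refine ⟨fun hv => ?_, fun hv => ?_⟩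
  · rw [← reflection_reflection n v]
    exact h _ _ hv
  · have := h _ _ hv
    rwa [swapRays, Equiv.swap_apply_self] at this

theorem preimage_reflection_face₁₂ (n : ℕ) :
    reflection n ⁻¹' Cell.face₁₂.cone n = Cell.face₁₂.cone n := by
  ext v
  simp only [mem_preimage, reflection_apply, Cell.cone,
    Matrix.cons_val_zero, Matrix.cons_val_one, Matrix.cons_val, mem_ofPred_eq]
  constructor <;> rintro ⟨h1, h2, h3, h4, h5⟩ <;> have := wall_eq_zero (n := n) h1 h3 <;>
    exact ⟨h1, h2, h3, by linarith, by linarith⟩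

theorem preimage_reflection_face₁₃ (n : ℕ) :
    reflection n ⁻¹' Cell.face₁₃.cone n = Cell.face₂₃.cone n := by
  ext v
  simp only [mem_preimage, reflection_apply, Cell.cone, wall_reflection,
    Matrix.cons_val_zero, Matrix.cons_val_one, Matrix.cons_val, mem_ofPred_eq]
  constructor <;> rintro ⟨h1, h2, h3⟩ <;> exact ⟨h1, h2, by linarith⟩

theorem preimage_reflection_face₂₃ (n : ℕ) :
    reflection n ⁻¹' Cell.face₂₃.cone n = Cell.face₁₃.cone n := by
  rw [← preimage_reflection_face₁₃, ← preimage_comp]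
  convert preimage_id
  exact funext (reflection_reflection n)

theorem isFaceOfSigma_preimage_reflection {n : ℕ} (hn : 1 ≤ n) {W : Set NR}
    (hW : IsFaceOfSigma n W) : IsFaceOfSigma n (reflection n ⁻¹' W) := by
  rw [isFaceOfSigma_iff hn] at hW ⊢
  rcases hW with rfl | rfl | rfl
  · simp [preimage_reflection_face₁₂]
  · simp [preimage_reflection_face₁₃]
  · simp [preimage_reflection_face₂₃]

theorem preimage_reflection_mem_subdivisionCones {n : ℕ} (hn : 1 ≤ n) {P τ : Set NR}
    (h : τ ∈ subdivisionCones n P) :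
    reflection n ⁻¹' τ ∈ subdivisionCones n (reflection n ⁻¹' P) := by
  rcases h with ((⟨i, rfl⟩ | h) | rfl) | ⟨v, hv, rfl⟩
  · exact Or.inl (Or.inl (Or.inl ⟨_, (preimage_reflection_rho n i).symm⟩))
  · exact Or.inl (Or.inl (Or.inr (isFaceOfSigma_preimage_reflection hn h)))
  · exact Or.inl (Or.inr rfl)
  · have e : sigma n \ reflection n ⁻¹' P = (reflection n).symm '' (sigma n \ P) := by
      rw [(reflection n).image_symm, preimage_sdiff, preimage_reflection_sigma]
    refine Or.inr ⟨(reflection n).symm v, e ▸ mem_image_of_mem _ hv, ?_⟩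
    rw [e, ← (reflection n).symm.image_connectedComponentIn hv, ← Homeomorph.image_closure,
      (reflection n).image_symm]

theorem subdivisionCones_rightPlane {n : ℕ} (hn : 1 ≤ n) :
    subdivisionCones n (rightPlane n) = range fun k : Cell => reflection n ⁻¹' k.cone n := by
  have hP : reflection n ⁻¹' leftPlane n = rightPlane n := by
    rw [leftPlane_eq, rightPlane_eq, preimage_reflection_plane]
  have hi : ∀ τ : Set NR, reflection n ⁻¹' (reflection n ⁻¹' τ) = τ := fun τ => by
    rw [← preimage_comp]
    convert preimage_id
    exact funext (reflection_reflection n)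
  ext τ
  constructor
  · intro h
    have := preimage_reflection_mem_subdivisionCones hn h
    rw [← hP, hi, subdivisionCones_leftPlane hn] at this
    obtain ⟨k, hk⟩ := this
    exact ⟨k, by simp only [hk, hi]⟩
  · rintro ⟨k, rfl⟩
    rw [← hP]
    exact preimage_reflection_mem_subdivisionCones hn
      (subdivisionCones_leftPlane hn ▸ mem_range_self k)

/-! ### The Zariski topology of `𝔸⁴ × ℙ¹` -/

/-- The grading for which "homogeneous in `α, β`" means weighted homogeneous. -/
abbrev dirWeight : Fin 4 ⊕ Fin 2 → ℕ := Sum.elim (fun _ => 0) (fun _ => 1)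

theorem eval_smul_of_isWeightedHomogeneous {F : MvPolynomial (Fin 4 ⊕ Fin 2) ℂ} {k : ℕ}
    (hF : MvPolynomial.IsWeightedHomogeneous dirWeight F k) (p : Fin 4 → ℂ) (d : Fin 2 → ℂ)
    (c : ℂ) : MvPolynomial.eval (Sum.elim p (c • d)) F =
      c ^ k * MvPolynomial.eval (Sum.elim p d) F := by
  rw [MvPolynomial.eval_eq', MvPolynomial.eval_eq', Finset.mul_sum]
  refine Finset.sum_congr rfl fun m hm => ?_
  have hk := hF (MvPolynomial.mem_support_iff.1 hm)
  rw [Finsupp.weight_apply, Finsupp.sum_fintype _ _ (by simp), Fintype.sum_sum_type] at hk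
  simp at hk
  rw [Fintype.prod_sum_type, Fintype.prod_sum_type, ← hk]
  simp
  ring

theorem AffProj.isOpen_eval_ne_zero {F : MvPolynomial (Fin 4 ⊕ Fin 2) ℂ} {k : ℕ}
    (hF : MvPolynomial.IsWeightedHomogeneous dirWeight F k) : IsOpen {q : AffProj | q.eval F ≠ 0} :=
  TopologicalSpace.isOpen_generateFrom_of_mem ⟨F, k, hF, rfl⟩

theorem AffProj.isClosed_eval_eq_zero {F : MvPolynomial (Fin 4 ⊕ Fin 2) ℂ} {k : ℕ}
    (hF : MvPolynomial.IsWeightedHomogeneous dirWeight F k) :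
    IsClosed {q : AffProj | q.eval F = 0} :=
  ⟨isOpen_eval_ne_zero hF⟩

theorem AffProj.exists_eval_ne_zero {U : Set AffProj} (hU : IsOpen U) {q : AffProj} (hq : q ∈ U) :
    ∃ (F : MvPolynomial (Fin 4 ⊕ Fin 2) ℂ) (k : ℕ),
      MvPolynomial.IsWeightedHomogeneous dirWeight F k ∧ q.eval F ≠ 0 ∧
        ∀ r : AffProj, r.eval F ≠ 0 → r ∈ U := by
  have hb : TopologicalSpace.IsTopologicalBasis {O : Set AffProj |
      ∃ (F : MvPolynomial (Fin 4 ⊕ Fin 2) ℂ) (k : ℕ),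
        MvPolynomial.IsWeightedHomogeneous dirWeight F k ∧ O = {q | q.eval F ≠ 0}} := by
    refine ⟨?_, ?_, rfl⟩
    · rintro _ ⟨F, k, hF, rfl⟩ _ ⟨G, l, hG, rfl⟩ r hr
      refine ⟨_, ⟨F * G, k + l, hF.mul hG, rfl⟩, ?_, fun s hs => ?_⟩
      · simpa [AffProj.eval] using hr
      · simpa [AffProj.eval] using hs
    · refine eq_univ_of_forall fun r =>
        ⟨_, ⟨1, 0, MvPolynomial.isWeightedHomogeneous_one _ _, rfl⟩, ?_⟩
      simp [AffProj.eval]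
  obtain ⟨_, ⟨F, k, hF, rfl⟩, h1, h2⟩ := hb.exists_subset_of_mem_open hq hU
  exact ⟨F, k, hF, h1, fun r hr => h2 hr⟩

theorem AffProj.isClosed_pt_eq_zero (i : Fin 4) : IsClosed {q : AffProj | q.pt i = 0} := by
  have := isClosed_eval_eq_zero (MvPolynomial.isWeightedHomogeneous_X ℂ dirWeight (Sum.inl i))
  simpa [AffProj.eval] using this

theorem AffProj.isClosed_rep_eq_zero (j : Fin 2) : IsClosed {q : AffProj | q.dir.rep j = 0} := by
  have := isClosed_eval_eq_zero (MvPolynomial.isWeightedHomogeneous_X ℂ dirWeight (Sum.inr j))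
  simpa [AffProj.eval] using this

theorem AffProj.isClosed_incidence (i j : Fin 4) (m : ℕ) :
    IsClosed {q : AffProj | q.pt i * q.dir.rep 0 = q.pt j ^ m * q.dir.rep 1} := by
  have hX := MvPolynomial.isWeightedHomogeneous_X ℂ dirWeight
  have h1 := (hX (Sum.inl i)).mul (hX (Sum.inr 0))
  have h2 := ((hX (Sum.inl j)).pow m).mul (hX (Sum.inr 1))
  have e : m • dirWeight (Sum.inl j) + dirWeight (Sum.inr 1) =
    dirWeight (Sum.inl i) + dirWeight (Sum.inr 0) := by simp
  have := isClosed_eval_eq_zero (h1.sub (e ▸ h2))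
  simpa [AffProj.eval, sub_eq_zero] using this

theorem AffProj.rep_ne_zero (q : AffProj) : q.dir.rep 0 ≠ 0 ∨ q.dir.rep 1 ≠ 0 := by
  by_contra h
  push Not at h
  exact q.dir.rep_nonzero (by ext i; fin_cases i <;> simp [h.1, h.2])

theorem AffProj.exists_point (p : Fin 4 → ℂ) {d : Fin 2 → ℂ} (hd : d ≠ 0) :
    ∃ (q : AffProj) (c : ℂ), c ≠ 0 ∧ q.pt = p ∧ d = c • q.dir.rep := by
  obtain ⟨a, ha⟩ := Projectivization.exists_smul_eq_mk_rep ℂ d hd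
  refine ⟨⟨p, Projectivization.mk ℂ d hd⟩, ((a⁻¹ : ℂˣ) : ℂ), (a⁻¹).ne_zero, rfl, ?_⟩
  change d = a⁻¹ • (Projectivization.mk ℂ d hd).rep
  rw [← ha, inv_smul_smul]

/-- A subset of `𝔸⁴ × ℙ¹` that is the image of the open set `g ≠ 0` of an affine space under a
polynomial map `(f, [g])` is irreducible: the preimage of a basic open set is the nonvanishing set
of a polynomial, and a product of nonzero polynomials over `ℂ` has a point where it does not
vanish. -/
theorem isIrreducible_of_parametrization {σ : Type} {S : Set AffProj}
    (f : Fin 4 → MvPolynomial σ ℂ) (g : Fin 2 → MvPolynomial σ ℂ) (hne : S.Nonempty)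
    (hS : ∀ q : AffProj, q ∈ S ↔ ∃ (s : σ → ℂ) (c : ℂ), c ≠ 0 ∧
      (∀ i, q.pt i = MvPolynomial.eval s (f i)) ∧
      ∀ j, MvPolynomial.eval s (g j) = c * q.dir.rep j) : IsIrreducible S := by
  have hev : ∀ {F k}, MvPolynomial.IsWeightedHomogeneous dirWeight F k →
      ∀ {q : AffProj} {s : σ → ℂ} {c : ℂ}, (∀ i, q.pt i = MvPolynomial.eval s (f i)) →
      (∀ j, MvPolynomial.eval s (g j) = c * q.dir.rep j) →
      MvPolynomial.eval s (MvPolynomial.bind₁ (Sum.elim f g) F) = c ^ k * q.eval F := by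
    intro F k hF q s c h1 h2
    have h3 : (fun i => MvPolynomial.eval s (Sum.elim f g i)) =
        Sum.elim q.pt (c • q.dir.rep) := by
      ext (i | j)
      · exact (h1 i).symm
      · exact h2 j
    rw [AffProj.eval, ← eval_smul_of_isWeightedHomogeneous hF, ← h3]
    exact MvPolynomial.eval₂Hom_bind₁ _ _ _ _
  refine ⟨hne, ?_⟩
  rintro U V hU hV ⟨q₁, hq₁, hU₁⟩ ⟨q₂, hq₂, hV₂⟩
  obtain ⟨F₁, k₁, hF₁, hF₁q, hF₁U⟩ := AffProj.exists_eval_ne_zero hU hU₁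
  obtain ⟨F₂, k₂, hF₂, hF₂q, hF₂V⟩ := AffProj.exists_eval_ne_zero hV hV₂
  obtain ⟨s₁, c₁, hc₁, hp₁, hd₁⟩ := (hS q₁).1 hq₁
  obtain ⟨s₂, c₂, hc₂, hp₂, hd₂⟩ := (hS q₂).1 hq₂
  set G₁ := MvPolynomial.bind₁ (Sum.elim f g) F₁
  set G₂ := MvPolynomial.bind₁ (Sum.elim f g) F₂
  have hne0 : ∀ {G : MvPolynomial σ ℂ} {s}, MvPolynomial.eval s G ≠ 0 → G ≠ 0 := by
    rintro G s h rfl; simp at h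
  have hG₁ : G₁ ≠ 0 := hne0 (s := s₁) (by rw [hev hF₁ hp₁ hd₁]; positivity)
  have hG₂ : G₂ ≠ 0 := hne0 (s := s₂) (by rw [hev hF₂ hp₂ hd₂]; positivity)
  have hg : ∃ j, g j ≠ 0 := by
    rcases q₁.rep_ne_zero with h | h
    · exact ⟨0, hne0 (s := s₁) (by rw [hd₁]; exact mul_ne_zero hc₁ h)⟩
    · exact ⟨1, hne0 (s := s₁) (by rw [hd₁]; exact mul_ne_zero hc₁ h)⟩
  obtain ⟨j, hj⟩ := hg
  obtain ⟨s, hs⟩ : ∃ s, MvPolynomial.eval s (G₁ * G₂ * g j) ≠ 0 := by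
    by_contra! h
    exact mul_ne_zero (mul_ne_zero hG₁ hG₂) hj (MvPolynomial.funext fun s => by simpa using h s)
  simp only [map_mul] at hs
  obtain ⟨q, c, hc, hp, hd⟩ := AffProj.exists_point (fun i => MvPolynomial.eval s (f i))
    (d := fun j => MvPolynomial.eval s (g j)) fun h => right_ne_zero_of_mul hs (congrFun h j)
  have hp' := fun i => congrFun hp i
  have hd' : ∀ j, MvPolynomial.eval s (g j) = c * q.dir.rep j := fun j => congrFun hd j
  refine ⟨q, (hS q).2 ⟨s, c, hc, hp', hd'⟩, hF₁U q ?_, hF₂V q ?_⟩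
  · have := left_ne_zero_of_mul (left_ne_zero_of_mul hs)
    rw [hev hF₁ hp' hd'] at this
    exact right_ne_zero_of_mul this
  · have := right_ne_zero_of_mul (left_ne_zero_of_mul hs)
    rw [hev hF₂ hp' hd'] at this
    exact right_ne_zero_of_mul this

/-! ### Irreducible components -/

theorem isComponent_iff_of_isIrreducible {S T : Set AffProj} (hT : IsIrreducible T) :
    IsComponent S T ↔ S = T := by
  constructor
  · intro h
    exact h.eq_of_subset ⟨hT, Subset.rfl⟩ h.prop.2
  · rintro rfl
    exact ⟨⟨hT, Subset.rfl⟩, fun R hR _ => hR.2⟩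

theorem not_isComponent_empty (S : Set AffProj) : ¬ IsComponent S ∅ := fun h =>
  h.prop.1.nonempty.ne_empty (subset_empty_iff.1 h.prop.2)

theorem isComponent_union_iff {S A B : Set AffProj} (hA : IsIrreducible A) (hB : IsIrreducible B)
    (cA : IsClosed A) (cB : IsClosed B) (hAB : ¬ A ⊆ B) (hBA : ¬ B ⊆ A) :
    IsComponent S (A ∪ B) ↔ S = A ∨ S = B := by
  have key : ∀ R, IsIrreducible R → R ⊆ A ∪ B → R ⊆ A ∨ R ⊆ B := fun R hR h =>
    isPreirreducible_iff_isClosed_union_isClosed.1 hR.2 A B cA cB h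
  constructor
  · intro h
    rcases key S h.prop.1 h.prop.2 with h' | h'
    · exact Or.inl (h.eq_of_subset ⟨hA, subset_union_left⟩ h')
    · exact Or.inr (h.eq_of_subset ⟨hB, subset_union_right⟩ h')
  · rintro (rfl | rfl)
    · refine ⟨⟨hA, subset_union_left⟩, fun R hR h => ?_⟩
      exact (key R hR.1 hR.2).resolve_right fun h' => hAB (h.trans h')
    · refine ⟨⟨hB, subset_union_right⟩, fun R hR h => ?_⟩
      exact (key R hR.1 hR.2).resolve_left fun h' => hBA (h.trans h')

theorem IsComponent.preimage (e : AffProj ≃ₜ AffProj) {S T : Set AffProj} (h : IsComponent S T) :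
    IsComponent (e ⁻¹' S) (e ⁻¹' T) := by
  refine ⟨⟨?_, preimage_mono h.prop.2⟩, fun R hR hS => ?_⟩
  · rw [← e.image_symm]
    exact h.prop.1.image _ e.symm.continuous.continuousOn
  · have h1 : IsIrreducible (e '' R) := hR.1.image _ e.continuous.continuousOn
    have h2 : S ⊆ e '' R := by
      rw [← e.image_preimage S]
      exact image_mono hS
    rw [← image_subset_iff]
    exact h.2 ⟨h1, image_subset_iff.2 hR.2⟩ h2

theorem IsStratum.preimage (e : AffProj ≃ₜ AffProj) {E E' : Fin 3 → Set AffProj}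
    {π : Fin 3 → Fin 3} (hE : ∀ i, e ⁻¹' E i = E' (π i)) {S : Set AffProj} (h : IsStratum E S) :
    IsStratum E' (e ⁻¹' S) := by
  induction h with
  | component i S h => exact .component (π i) _ (hE i ▸ h.preimage e)
  | inter S T R _ _ h ihS ihT => exact .inter _ _ _ ihS ihT (h.preimage e)

/-! ### The strata in the small resolution `X` -/

/-- The stratum of `D̃ ⊂ X` dual to the cone of a cell: the strict transforms `D̃ᵢ` for the rays,
the `t`-axis, the `z`-axis and the `x`-axis at the appropriate point of `ℙ¹` for the faces, the
exceptional curve for the subdividing plane, and the points `(1 : 0)`, `(0 : 1)` of the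
exceptional curve for the three-dimensional cones. -/
def Cell.stratum (n : ℕ) (k : Cell) : Set AffProj :=
  {q | match k with
    | ray₁ => q.pt 0 = 0 ∧ q.pt 1 = 0 ∧ q.dir.rep 1 = 0
    | ray₂ => q.pt 1 = 0 ∧ q.pt 2 = 0 ∧ q.pt 0 * q.dir.rep 0 = q.pt 3 ^ n * q.dir.rep 1
    | ray₃ => q.pt 3 = 0 ∧ q.pt 1 * q.dir.rep 0 = q.pt 2 * q.dir.rep 1 ∧
        q.pt 0 * q.dir.rep 0 = q.pt 1 * q.dir.rep 1
    | face₁₂ => q.pt 0 = 0 ∧ q.pt 1 = 0 ∧ q.pt 2 = 0 ∧ q.dir.rep 1 = 0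
    | face₁₃ => q.pt 0 = 0 ∧ q.pt 1 = 0 ∧ q.pt 3 = 0 ∧ q.dir.rep 1 = 0
    | face₂₃ => q.pt 1 = 0 ∧ q.pt 2 = 0 ∧ q.pt 3 = 0 ∧ q.dir.rep 0 = 0
    | plane => q.pt 0 = 0 ∧ q.pt 1 = 0 ∧ q.pt 2 = 0 ∧ q.pt 3 = 0
    | outer => q.pt 0 = 0 ∧ q.pt 1 = 0 ∧ q.pt 2 = 0 ∧ q.pt 3 = 0 ∧ q.dir.rep 1 = 0
    | inner => q.pt 0 = 0 ∧ q.pt 1 = 0 ∧ q.pt 2 = 0 ∧ q.pt 3 = 0 ∧ q.dir.rep 0 = 0}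

/-- Coordinates of a point of each stratum that lies in no smaller stratum. -/
def Cell.genericPoint : Cell → (Fin 4 → ℂ) × (Fin 2 → ℂ)
  | ray₁ => (![0, 0, 1, 1], ![1, 0])
  | ray₂ => (![1, 0, 0, 1], ![1, 1])
  | ray₃ => (![1, 1, 1, 0], ![1, 1])
  | face₁₂ => (![0, 0, 0, 1], ![1, 0])
  | face₁₃ => (![0, 0, 1, 0], ![1, 0])
  | face₂₃ => (![1, 0, 0, 0], ![0, 1])
  | plane => (![0, 0, 0, 0], ![1, 1])
  | outer => (![0, 0, 0, 0], ![1, 0])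
  | inner => (![0, 0, 0, 0], ![0, 1])

theorem Cell.exists_genericPoint {n : ℕ} (hn : 1 ≤ n) (a : Cell) :
    ∃ q : AffProj, q.pt = a.genericPoint.1 ∧
      ∀ b : Cell, q ∈ b.stratum n ↔ b.features ⊆ a.features := by
  have hn' : n ≠ 0 := by omega
  have hd : a.genericPoint.2 ≠ 0 := by
    intro h
    have h0 := congrFun h 0
    have h1 := congrFun h 1
    cases a <;> simp [genericPoint] at h0 h1
  obtain ⟨q, c, hc, hp, hq⟩ := AffProj.exists_point a.genericPoint.1 hd
  refine ⟨q, hp, fun b => ?_⟩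
  have e0 : q.dir.rep 0 = c⁻¹ * a.genericPoint.2 0 := by rw [hq]; simp [hc]
  have e1 : q.dir.rep 1 = c⁻¹ * a.genericPoint.2 1 := by rw [hq]; simp [hc]
  cases a <;> cases b <;>
    simp [stratum, hp, e0, e1, genericPoint, features, Finset.subset_iff, hc, hn']

theorem Cell.stratum_subset_of_features_subset {n : ℕ} (hn : 1 ≤ n) {a b : Cell}
    (h : a.features ⊆ b.features) : b.stratum n ⊆ a.stratum n := by
  have hn' : n ≠ 0 := by omega
  intro q hq
  cases a <;> cases b <;>
    first
      | exact absurd h (by decide)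
      | exact hq
      | (simp only [stratum, mem_ofPred_eq] at hq ⊢
         simp [hq, hn'])

theorem Cell.stratum_subset_iff {n : ℕ} (hn : 1 ≤ n) {a b : Cell} :
    b.stratum n ⊆ a.stratum n ↔ a.features ⊆ b.features := by
  refine ⟨fun h => ?_, stratum_subset_of_features_subset hn⟩
  obtain ⟨q, -, hq⟩ := b.exists_genericPoint hn
  exact (hq a).1 (h ((hq b).2 subset_rfl))

theorem Cell.isClosed_stratum (n : ℕ) (k : Cell) : IsClosed (k.stratum n) := by
  have h (i j : Fin 4) : IsClosed {q : AffProj | q.pt i * q.dir.rep 0 = q.pt j * q.dir.rep 1} := by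
    simpa using AffProj.isClosed_incidence i j 1
  cases k <;> simp only [stratum, ofPred_and] <;>
    repeat' first
      | apply IsClosed.inter
      | exact AffProj.isClosed_pt_eq_zero _
      | exact AffProj.isClosed_rep_eq_zero _
      | exact AffProj.isClosed_incidence _ _ _
      | exact h _ _

open MvPolynomial in
/-- The surface `xα = tⁿβ` is parametrised by `x = uⁿwⁿ`, `t = uv`, `(α : β) = (vⁿ : wⁿ)`; this is
onto because `n`-th roots exist in `ℂ`. -/
theorem isIrreducible_stratum_ray₂ {n : ℕ} (hn : 1 ≤ n) (hne : (Cell.ray₂.stratum n).Nonempty) :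
    IsIrreducible (Cell.ray₂.stratum n) := by
  have hn' : n ≠ 0 := by omega
  have root : ∀ a : ℂ, ∃ b : ℂ, b ^ n = a := fun a => IsAlgClosed.exists_pow_nat_eq a (by omega)
  refine isIrreducible_of_parametrization (σ := Fin 3)
    ![X 0 ^ n * X 2 ^ n, 0, 0, X 0 * X 1] ![X 1 ^ n, X 2 ^ n] hne fun q => ?_
  have hr := q.rep_ne_zero
  constructor
  · rintro ⟨h1, h2, h⟩
    obtain ⟨v, hv⟩ := root (q.dir.rep 0)
    obtain ⟨w, hw⟩ := root (q.dir.rep 1)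
    obtain ⟨u, hx, ht⟩ : ∃ u, q.pt 0 = u ^ n * w ^ n ∧ q.pt 3 = u * v := by
      rw [← hv, ← hw] at h hr
      by_cases hv0 : v = 0
      · have hw0 : w ≠ 0 := by rintro rfl; simp [hv0, hn'] at hr
        have ht : q.pt 3 = 0 := by simpa [hv0, hn', hw0] using h
        obtain ⟨r, hr⟩ := root (q.pt 0)
        exact ⟨r / w, by rw [div_pow, div_mul_cancel₀ _ (pow_ne_zero n hw0), hr], by simp [hv0, ht]⟩
      · refine ⟨q.pt 3 / v, ?_, by field_simp⟩
        rw [div_pow, div_mul_eq_mul_div, eq_div_iff (pow_ne_zero n hv0), h]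
    refine ⟨![u, v, w], 1, one_ne_zero, ?_, ?_⟩ <;>
      simp [Fin.forall_fin_succ, h1, h2, hv, hw, hx, ht]
  · rintro ⟨s, c, hc, hf, hg⟩
    simp [Fin.forall_fin_succ] at hf hg
    refine ⟨hf.2.1, hf.2.2.1, mul_left_cancel₀ hc ?_⟩
    rw [mul_left_comm, ← hg.1, mul_left_comm, ← hg.2, hf.1, hf.2.2.2]
    ring

open MvPolynomial in
/-- The resolution of the cone `xz = y²` is parametrised by `(x, y, z) = (rβ², rαβ, rα²)`. -/
theorem isIrreducible_stratum_ray₃ {n : ℕ} (hne : (Cell.ray₃.stratum n).Nonempty) :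
    IsIrreducible (Cell.ray₃.stratum n) := by
  refine isIrreducible_of_parametrization (σ := Fin 3)
    ![X 0 * X 2 ^ 2, X 0 * X 1 * X 2, X 0 * X 1 ^ 2, 0] ![X 1, X 2] hne fun q => ?_
  have hr := q.rep_ne_zero
  constructor
  · rintro ⟨h1, h2, h3⟩
    set α := q.dir.rep 0
    set β := q.dir.rep 1
    obtain ⟨r, hx, hy, hz⟩ : ∃ r, q.pt 0 = r * β ^ 2 ∧ q.pt 1 = r * α * β ∧
        q.pt 2 = r * α ^ 2 := by
      by_cases hβ : β = 0
      · have hα : α ≠ 0 := hr.resolve_right (not_not.2 hβ)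
        rw [hβ, mul_zero] at h2 h3
        refine ⟨q.pt 2 / α ^ 2, ?_, ?_, by field_simp⟩
        · simpa [hα, hβ] using h3
        · simpa [hα, hβ] using h2
      · have hy : q.pt 1 = q.pt 0 * α / β := by rw [eq_div_iff hβ, h3]
        have hz : q.pt 2 = q.pt 1 * α / β := by rw [eq_div_iff hβ, h2]
        exact ⟨q.pt 0 / β ^ 2, by field_simp, by rw [hy]; field_simp, by rw [hz, hy]; field_simp⟩
    refine ⟨![r, α, β], 1, one_ne_zero, ?_, ?_⟩ <;>
      simp [Fin.forall_fin_succ, h1, hx, hy, hz, α, β]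
  · rintro ⟨s, c, hc, hf, hg⟩
    simp [Fin.forall_fin_succ] at hf hg
    refine ⟨hf.2.2.2, mul_left_cancel₀ hc ?_, mul_left_cancel₀ hc ?_⟩ <;>
      rw [mul_left_comm, ← hg.1, mul_left_comm, ← hg.2] <;> simp only [hf] <;> ring

open MvPolynomial in
theorem Cell.isIrreducible_stratum {n : ℕ} (hn : 1 ≤ n) (k : Cell) :
    IsIrreducible (k.stratum n) := by
  have hne : (k.stratum n).Nonempty := by
    obtain ⟨q, -, hq⟩ := k.exists_genericPoint hn
    exact ⟨q, (hq k).2 subset_rfl⟩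
  cases k
  case ray₂ => exact isIrreducible_stratum_ray₂ hn hne
  case ray₃ => exact isIrreducible_stratum_ray₃ hne
  case ray₁ =>
    refine isIrreducible_of_parametrization (σ := Fin 3) ![0, 0, X 0, X 1] ![X 2, 0] hne
      fun q => ⟨fun h => ⟨![q.pt 2, q.pt 3, q.dir.rep 0], 1, ?_⟩, ?_⟩
    all_goals simp [stratum, Fin.forall_fin_succ] at *
    all_goals grind
  case face₁₂ =>
    refine isIrreducible_of_parametrization (σ := Fin 2) ![0, 0, 0, X 0] ![X 1, 0] hne
      fun q => ⟨fun h => ⟨![q.pt 3, q.dir.rep 0], 1, ?_⟩, ?_⟩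
    all_goals simp [stratum, Fin.forall_fin_succ] at *
    all_goals grind
  case face₁₃ =>
    refine isIrreducible_of_parametrization (σ := Fin 2) ![0, 0, X 0, 0] ![X 1, 0] hne
      fun q => ⟨fun h => ⟨![q.pt 2, q.dir.rep 0], 1, ?_⟩, ?_⟩
    all_goals simp [stratum, Fin.forall_fin_succ] at *
    all_goals grind
  case face₂₃ =>
    refine isIrreducible_of_parametrization (σ := Fin 2) ![X 0, 0, 0, 0] ![0, X 1] hne
      fun q => ⟨fun h => ⟨![q.pt 0, q.dir.rep 1], 1, ?_⟩, ?_⟩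
    all_goals simp [stratum, Fin.forall_fin_succ] at *
    all_goals grind
  case plane =>
    refine isIrreducible_of_parametrization (σ := Fin 2) ![0, 0, 0, 0] ![X 0, X 1] hne
      fun q => ⟨fun h => ⟨![q.dir.rep 0, q.dir.rep 1], 1, ?_⟩, ?_⟩
    all_goals simp [stratum, Fin.forall_fin_succ] at *
    all_goals grind
  case outer =>
    refine isIrreducible_of_parametrization (σ := Fin 1) ![0, 0, 0, 0] ![X 0, 0] hne
      fun q => ⟨fun h => ⟨![q.dir.rep 0], 1, ?_⟩, ?_⟩
    all_goals simp [stratum, Fin.forall_fin_succ] at *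
    all_goals grind
  case inner =>
    refine isIrreducible_of_parametrization (σ := Fin 1) ![0, 0, 0, 0] ![0, X 0] hne
      fun q => ⟨fun h => ⟨![q.dir.rep 1], 1, ?_⟩, ?_⟩
    all_goals simp [stratum, Fin.forall_fin_succ] at *
    all_goals grind

/-- An irreducible closed set is the closure of its part away from the exceptional curve, so that it
is the strict transform of any `Dᵢ` with which it agrees there. -/
theorem strictTransform_eq_of_isIrreducible {n : ℕ} {Z S : Set AffProj} {i : Fin 3}
    (hS : IsIrreducible S) (hc : IsClosed S) (hne : ∃ q ∈ S, q.pt ≠ 0)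
    (h : ∀ q : AffProj, q.pt ≠ 0 → (q ∈ Z ∧ q.pt ∈ boundary n i ↔ q ∈ S)) :
    strictTransform n Z i = S := by
  have hU : IsOpen {q : AffProj | q.pt ≠ 0} := by
    have : {q : AffProj | q.pt ≠ 0} = ⋃ i, {q : AffProj | q.pt i = 0}ᶜ := by
      ext q
      simp [funext_iff]
    rw [this]
    exact isOpen_iUnion fun i => (AffProj.isClosed_pt_eq_zero i).isOpen_compl
  have e : {q ∈ Z | q.pt ∈ boundary n i \ {0}} = S ∩ {q : AffProj | q.pt ≠ 0} := by
    ext q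
    constructor
    · rintro ⟨h1, h2, h3⟩
      exact ⟨(h q h3).1 ⟨h1, h2⟩, h3⟩
    · rintro ⟨h1, h2⟩
      obtain ⟨h3, h4⟩ := (h q h2).2 h1
      exact ⟨h3, h4, h2⟩
  rw [strictTransform, e]
  exact (closure_minimal inter_subset_left hc).antisymm
    (subset_closure_inter_of_isPreirreducible_of_isOpen hS.2 hU hne)

/-- The cell of the ray `ρᵢ`. -/
def Cell.ray : Fin 3 → Cell := ![ray₁, ray₂, ray₃]

theorem strictTransform_smallResolution {n : ℕ} (hn : 1 ≤ n) (i : Fin 3) :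
    strictTransform n (smallResolution n) i = (Cell.ray i).stratum n := by
  have hn' : n ≠ 0 := by omega
  refine strictTransform_eq_of_isIrreducible (Cell.isIrreducible_stratum hn _)
    (Cell.isClosed_stratum n _) ?_ fun q hq => ?_
  · obtain ⟨q, hp, hq⟩ := (Cell.ray i).exists_genericPoint hn
    refine ⟨q, (hq _).2 subset_rfl, ?_⟩
    rw [hp]
    fin_cases i <;> simp [Cell.ray, Cell.genericPoint]
  · have hY := pt_mem_Y n q
    simp only [smallResolution, Y, mem_union, mem_ofPred_eq] at hY ⊢
    have hq' : ¬ (q.pt 0 = 0 ∧ q.pt 1 = 0 ∧ q.pt 2 = 0 ∧ q.pt 3 = 0) := fun h =>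
      hq (by ext i; fin_cases i <;> simp [h])
    fin_cases i
    · simp [boundary, Cell.ray, Cell.stratum, Y]
      constructor
      · rintro ⟨⟨h1, h2⟩, h3, h4, h5⟩
        rw [h5, zero_mul] at h1
        rw [h4, h5, zero_mul, zero_add] at h2
        refine ⟨h4, h5, ?_⟩
        by_contra hβ
        exact hq' ⟨h4, h5, (mul_eq_zero.1 h1.symm).resolve_right hβ,
          (pow_eq_zero_iff hn').1 ((mul_eq_zero.1 h2.symm).resolve_right hβ)⟩
      · rintro ⟨h1, h2, h3⟩
        simp [h1, h2, h3]
    · simp [boundary, Cell.ray, Cell.stratum, Y]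
      constructor
      · rintro ⟨⟨h1, h2⟩, h3, h4, h5⟩
        simp [h4, h5] at *
        exact h2
      · rintro ⟨h1, h2, h3⟩
        simp [h1, h2, h3]
    · simp [boundary, Cell.ray, Cell.stratum, Y]
      constructor
      · rintro ⟨⟨h1, h2⟩, h3, h4, h5⟩
        simp [h5, hn'] at *
        exact ⟨h1, h2⟩
      · rintro ⟨h1, h2, h3⟩
        simp [h1, hn'] at *
        have := hY (Or.inl ⟨h2, h3⟩)
        exact ⟨⟨h2, h3⟩, this, by rw [this, sq]⟩

theorem exceptionalCurve_smallResolution {n : ℕ} (hn : 1 ≤ n) :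
    exceptionalCurve (smallResolution n) = Cell.plane.stratum n := by
  have hn' : n ≠ 0 := by omega
  ext q
  simp only [exceptionalCurve, smallResolution, Cell.stratum, mem_ofPred_eq]
  constructor
  · rintro ⟨-, h⟩
    simp [h]
  · rintro ⟨h0, h1, h2, h3⟩
    exact ⟨by simp [h0, h1, h2, h3, hn'], by ext i; fin_cases i <;> simp [h0, h1, h2, h3]⟩

theorem Cell.stratum_inter_eq {n : ℕ} (hn : 1 ≤ n) {a b : Cell} (c : Cell)
    (ha : a.features ⊆ c.features) (hb : b.features ⊆ c.features)
    (h : ∀ q ∈ a.stratum n, q ∈ b.stratum n → q ∈ c.stratum n) :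
    a.stratum n ∩ b.stratum n = c.stratum n :=
  Subset.antisymm (fun q hq => h q hq.1 hq.2) (subset_inter
    (stratum_subset_of_features_subset hn ha) (stratum_subset_of_features_subset hn hb))

/-- On `D̃₂ ∩ D̃₃` the equation `xα = tⁿβ` becomes `xα = 0`, so that this intersection is the union
of two curves. -/
theorem Cell.stratum_ray₂_inter_stratum_ray₃ {n : ℕ} (hn : 1 ≤ n) :
    ray₂.stratum n ∩ ray₃.stratum n = plane.stratum n ∪ face₂₃.stratum n := by
  have hn' : n ≠ 0 := by omega
  ext q
  simp only [stratum, mem_inter_iff, mem_union, mem_ofPred_eq]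
  constructor
  · rintro ⟨⟨h1, h2, h3⟩, h4, -, -⟩
    rw [h4, zero_pow hn', zero_mul, mul_eq_zero] at h3
    exact h3.imp (fun h => ⟨h, h1, h2, h4⟩) fun h => ⟨h1, h2, h4, h⟩
  · rintro (⟨h0, h1, h2, h3⟩ | ⟨h0, h1, h2, h3⟩) <;> simp [*]

/-- Two strata meet in a stratum or not at all, except for `D̃₂` and `D̃₃`. -/
theorem Cell.stratum_inter_stratum {n : ℕ} (hn : 1 ≤ n) (a b : Cell) :
    a.stratum n ∩ b.stratum n = ∅ ∨ (∃ c : Cell, a.stratum n ∩ b.stratum n = c.stratum n) ∨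
      a.stratum n ∩ b.stratum n = plane.stratum n ∪ face₂₃.stratum n := by
  have hn' : n ≠ 0 := by omega
  by_cases hab : a.features ⊆ b.features
  · exact Or.inr (Or.inl ⟨b, inter_eq_right.2 (stratum_subset_of_features_subset hn hab)⟩)
  by_cases hba : b.features ⊆ a.features
  · exact Or.inr (Or.inl ⟨a, inter_eq_left.2 (stratum_subset_of_features_subset hn hba)⟩)
  have h23 := stratum_ray₂_inter_stratum_ray₃ hn
  have hrep := AffProj.rep_ne_zero
  cases a <;> cases b <;>
    first
      | exact absurd (by decide) hab
      | exact absurd (by decide) hba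
      | exact Or.inr (Or.inr h23)
      | exact Or.inr (Or.inr (inter_comm _ _ ▸ h23))
      | exact Or.inr (Or.inl ⟨face₁₂, stratum_inter_eq hn _ (by decide) (by decide)
          (by simp only [stratum, mem_ofPred_eq]; grind)⟩)
      | exact Or.inr (Or.inl ⟨face₁₃, stratum_inter_eq hn _ (by decide) (by decide)
          (by simp only [stratum, mem_ofPred_eq]; grind)⟩)
      | exact Or.inr (Or.inl ⟨inner, stratum_inter_eq hn _ (by decide) (by decide)
          (by simp only [stratum, mem_ofPred_eq]; grind)⟩)
      | exact Or.inr (Or.inl ⟨outer, stratum_inter_eq hn _ (by decide) (by decide)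
          (by simp only [stratum, mem_ofPred_eq]; grind)⟩)
      | (refine Or.inl (eq_empty_of_forall_notMem ?_)
         simp only [stratum, mem_inter_iff, mem_ofPred_eq]
         grind)

theorem isComponent_plane_union_face₂₃ {n : ℕ} (hn : 1 ≤ n) {S : Set AffProj} :
    IsComponent S (Cell.plane.stratum n ∪ Cell.face₂₃.stratum n) ↔
      S = Cell.plane.stratum n ∨ S = Cell.face₂₃.stratum n :=
  isComponent_union_iff (Cell.isIrreducible_stratum hn _) (Cell.isIrreducible_stratum hn _)
    (Cell.isClosed_stratum n _) (Cell.isClosed_stratum n _)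
    (by rw [Cell.stratum_subset_iff hn]; decide) (by rw [Cell.stratum_subset_iff hn]; decide)

theorem strata_smallResolution {n : ℕ} (hn : 1 ≤ n) :
    {S | IsStratum (strictTransform n (smallResolution n)) S} = range (Cell.stratum n) := by
  apply Subset.antisymm
  · intro S hS
    induction hS with
    | component i S h =>
      rw [strictTransform_smallResolution hn,
        isComponent_iff_of_isIrreducible (Cell.isIrreducible_stratum hn _)] at h
      exact ⟨_, h.symm⟩
    | inter S T R _ _ h ihS ihT =>
      obtain ⟨a, rfl⟩ := ihS
      obtain ⟨b, rfl⟩ := ihT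
      rcases Cell.stratum_inter_stratum hn a b with h' | ⟨c, h'⟩ | h' <;> rw [h'] at h
      · exact absurd h (not_isComponent_empty R)
      · rw [isComponent_iff_of_isIrreducible (Cell.isIrreducible_stratum hn _)] at h
        exact ⟨_, h.symm⟩
      · rw [isComponent_plane_union_face₂₃ hn] at h
        rcases h with rfl | rfl <;> exact mem_range_self _
  · have hray : ∀ i, IsStratum (strictTransform n (smallResolution n))
        ((Cell.ray i).stratum n) := fun i => by
      refine .component i _ ?_
      rw [strictTransform_smallResolution hn,
        isComponent_iff_of_isIrreducible (Cell.isIrreducible_stratum hn _)]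
    have hinter : ∀ {a b : Cell} (c : Cell), IsStratum (strictTransform n (smallResolution n))
        (a.stratum n) → IsStratum (strictTransform n (smallResolution n)) (b.stratum n) →
        a.stratum n ∩ b.stratum n = c.stratum n →
        IsStratum (strictTransform n (smallResolution n)) (c.stratum n) := fun c ha hb h =>
      .inter _ _ _ ha hb (by
        rw [h, isComponent_iff_of_isIrreducible (Cell.isIrreducible_stratum hn c)])
    have h₁ : IsStratum _ (Cell.ray₁.stratum n) := hray 0
    have h₂ : IsStratum _ (Cell.ray₂.stratum n) := hray 1
    have h₃ : IsStratum _ (Cell.ray₃.stratum n) := hray 2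
    have hplane := IsStratum.inter _ _ _ h₂ h₃
      (Cell.stratum_ray₂_inter_stratum_ray₃ hn ▸ (isComponent_plane_union_face₂₃ hn).2 (Or.inl rfl))
    have hface := IsStratum.inter _ _ _ h₂ h₃
      (Cell.stratum_ray₂_inter_stratum_ray₃ hn ▸ (isComponent_plane_union_face₂₃ hn).2 (Or.inr rfl))
    rintro _ ⟨k, rfl⟩
    cases k
    case ray₁ => exact h₁
    case ray₂ => exact h₂
    case ray₃ => exact h₃
    case plane => exact hplane
    case face₂₃ => exact hface
    case face₁₂ =>
      refine hinter _ h₁ h₂ (Cell.stratum_inter_eq hn _ (by decide) (by decide) ?_)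
      simp only [Cell.stratum, mem_ofPred_eq]
      grind
    case face₁₃ =>
      refine hinter _ h₁ h₃ (Cell.stratum_inter_eq hn _ (by decide) (by decide) ?_)
      simp only [Cell.stratum, mem_ofPred_eq]
      grind
    case outer =>
      refine hinter _ h₁ hplane (Cell.stratum_inter_eq hn _ (by decide) (by decide) ?_)
      simp only [Cell.stratum, mem_ofPred_eq]
      grind
    case inner =>
      refine hinter _ hface hplane (Cell.stratum_inter_eq hn _ (by decide) (by decide) ?_)
      simp only [Cell.stratum, mem_ofPred_eq]
      grind

/-! ### The isomorphism of the two small resolutions -/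

theorem isWeightedHomogeneous_rename {σ τ : Type*} {w : τ → ℕ} (e : σ → τ)
    {F : MvPolynomial σ ℂ} {k : ℕ} (hF : MvPolynomial.IsWeightedHomogeneous (w ∘ e) F k) :
    MvPolynomial.IsWeightedHomogeneous w (MvPolynomial.rename e F) k := by
  intro d hd
  obtain ⟨u, rfl, hu⟩ := MvPolynomial.coeff_rename_ne_zero e F d hd
  rw [← hF hu, Finsupp.weight_apply, Finsupp.weight_apply,
    Finsupp.sum_mapDomain_index (by simp) (by simp [add_mul])]
  rfl

/-- The involution of `𝔸⁴ × ℙ¹` that exchanges the coordinates `x` and `z`. -/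
def swapFun (q : AffProj) : AffProj := ⟨q.pt ∘ Equiv.swap 0 2, q.dir⟩

theorem swapFun_swapFun (q : AffProj) : swapFun (swapFun q) = q := by
  have : (q.pt ∘ Equiv.swap 0 2) ∘ Equiv.swap 0 2 = q.pt := by
    ext i; simp
  simp only [swapFun, this]

theorem continuous_swapFun : Continuous swapFun := by
  refine continuous_generateFrom_iff.2 ?_
  rintro _ ⟨F, k, hF, rfl⟩
  set e : Fin 4 ⊕ Fin 2 → Fin 4 ⊕ Fin 2 := Sum.map (Equiv.swap 0 2) id
  have hw : dirWeight ∘ e = dirWeight := by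
    ext (i | j) <;> rfl
  have hF' : MvPolynomial.IsWeightedHomogeneous (dirWeight ∘ e) F k := by rwa [hw]
  convert AffProj.isOpen_eval_ne_zero (isWeightedHomogeneous_rename e hF') using 1
  ext q
  simp only [mem_preimage, mem_ofPred_eq, AffProj.eval, MvPolynomial.eval_rename]
  have : Sum.elim q.pt q.dir.rep ∘ e = Sum.elim (swapFun q).pt (swapFun q).dir.rep := by
    ext (i | j) <;> rfl
  rw [this]

/-- The exchange of `x` and `z` as a homeomorphism. It maps the two small resolutions to each other
and exchanges `D₁` with `D₂`. -/
def swapHomeo : AffProj ≃ₜ AffProj where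
  toFun := swapFun
  invFun := swapFun
  left_inv := swapFun_swapFun
  right_inv := swapFun_swapFun
  continuous_toFun := continuous_swapFun
  continuous_invFun := continuous_swapFun

theorem preimage_swapHomeo_smallResolution (n : ℕ) :
    swapHomeo ⁻¹' smallResolution n = otherResolution n := rfl

theorem swapHomeo_pt (q : AffProj) : (swapHomeo q).pt = q.pt ∘ Equiv.swap 0 2 := rfl

theorem swapHomeo_pt_eq_zero_iff (q : AffProj) : (swapHomeo q).pt = 0 ↔ q.pt = 0 := by
  rw [swapHomeo_pt]
  constructor
  · intro h
    ext i
    simpa using congrFun h (Equiv.swap 0 2 i)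
  · intro h
    simp [h]

theorem swapHomeo_pt_mem_boundary_iff (n : ℕ) (i : Fin 3) (q : AffProj) :
    (swapHomeo q).pt ∈ boundary n i ↔ q.pt ∈ boundary n (swapRays i) := by
  have h1 : Equiv.swap (0 : Fin 4) 2 1 = 1 := by decide
  have h3 : Equiv.swap (0 : Fin 4) 2 3 = 3 := by decide
  have e2 : Equiv.swap (0 : Fin 3) 1 2 = 2 := by decide
  rw [swapHomeo_pt]
  fin_cases i <;>
    simp [boundary, Y, swapRays, h1, h3, e2, mul_comm (q.pt 2), and_comm]

theorem preimage_swapHomeo_strictTransform (n : ℕ) (i : Fin 3) :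
    swapHomeo ⁻¹' strictTransform n (smallResolution n) i =
      strictTransform n (otherResolution n) (swapRays i) := by
  rw [strictTransform, strictTransform, swapHomeo.preimage_closure,
    ← preimage_swapHomeo_smallResolution]
  congr 1
  ext q
  simp only [mem_preimage, mem_ofPred_eq, mem_sdiff, mem_singleton_iff, swapHomeo_pt_eq_zero_iff,
    swapHomeo_pt_mem_boundary_iff]

theorem strata_otherResolution {n : ℕ} (hn : 1 ≤ n) :
    {S | IsStratum (strictTransform n (otherResolution n)) S} =
      range fun k : Cell => swapHomeo ⁻¹' k.stratum n := by
  have hinv : ∀ S : Set AffProj, swapHomeo ⁻¹' (swapHomeo ⁻¹' S) = S := fun S => by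
    rw [← preimage_comp]
    convert preimage_id
    exact funext swapFun_swapFun
  have hX := strata_smallResolution hn
  ext S
  constructor
  · intro hS
    have h : IsStratum (strictTransform n (smallResolution n)) (swapHomeo ⁻¹' S) := by
      refine hS.preimage swapHomeo (π := swapRays) fun i => ?_
      rw [← hinv (strictTransform n (smallResolution n) (swapRays i)),
        preimage_swapHomeo_strictTransform, swapRays, Equiv.swap_apply_self]
    obtain ⟨k, hk⟩ := hX.subset h
    exact ⟨k, by simp only [hk, hinv]⟩
  · rintro ⟨k, rfl⟩
    have h : IsStratum (strictTransform n (smallResolution n)) (k.stratum n) :=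
      hX.superset (mem_range_self k)
    exact h.preimage swapHomeo (preimage_swapHomeo_strictTransform n)

/-! ### Duality -/

theorem Cell.features_injective : Function.Injective Cell.features := by
  intro a b h
  cases a <;> cases b <;> first | rfl | exact absurd h (by decide)

theorem intersectionComplexDual_of_parametrization {n : ℕ} {Z : Set AffProj} {P : Set NR}
    (K : Cell → Set NR) (S : Cell → Set AffProj) (hK : subdivisionCones n P = range K)
    (hS : {R | IsStratum (strictTransform n Z) R} = range S)
    (hKle : ∀ a b : Cell, K a ⊆ K b ↔ a.features ⊆ b.features)
    (hSle : ∀ a b : Cell, S b ⊆ S a ↔ a.features ⊆ b.features)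
    (hray : ∀ i, ∃ k, K k = rho i ∧ S k = strictTransform n Z i)
    (hplane : K .plane = P ∧ S .plane = exceptionalCurve Z) :
    IntersectionComplexDual n Z P := by
  have hKi : Function.Injective K := fun a b h => Cell.features_injective
    (((hKle a b).1 h.subset).antisymm ((hKle b a).1 h.superset))
  have hSi : Function.Injective S := fun a b h => Cell.features_injective
    (((hSle a b).1 h.superset).antisymm ((hSle b a).1 h.subset))
  have hΦ : ∀ k, Function.extend K S (fun _ => ∅) (K k) = S k := fun k => hKi.extend_apply _ _ _
  refine ⟨Function.extend K S fun _ => ∅, ?_, ?_, ?_, ?_⟩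
  · rw [hK, hS]
    refine ⟨?_, ?_, ?_⟩
    · rintro _ ⟨k, rfl⟩
      exact ⟨k, (hΦ k).symm⟩
    · rintro _ ⟨a, rfl⟩ _ ⟨b, rfl⟩ h
      rw [hΦ, hΦ] at h
      rw [hSi h]
    · rintro _ ⟨k, rfl⟩
      exact ⟨K k, mem_range_self k, hΦ k⟩
  · rw [hK]
    rintro _ ⟨a, rfl⟩ _ ⟨b, rfl⟩
    rw [hΦ, hΦ, hKle, hSle]
  · intro i
    obtain ⟨k, h1, h2⟩ := hray i
    rw [← h1, hΦ, h2]
  · rw [← hplane.1, hΦ, hplane.2]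

theorem rho_eq (n : ℕ) (i : Fin 3) : (Cell.ray i).cone n = rho i := by
  fin_cases i
  · exact (rho_zero n).symm
  · exact (rho_one n).symm
  · exact (rho_two n).symm

theorem intersectionComplexDual_smallResolution {n : ℕ} (hn : 1 ≤ n) :
    IntersectionComplexDual n (smallResolution n) (leftPlane n) :=
  intersectionComplexDual_of_parametrization (Cell.cone n) (Cell.stratum n)
    (subdivisionCones_leftPlane hn) (strata_smallResolution hn)
    (fun _ _ => Cell.cone_subset_iff hn) (fun _ _ => Cell.stratum_subset_iff hn)
    (fun i => ⟨Cell.ray i, rho_eq n i, (strictTransform_smallResolution hn i).symm⟩)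
    ⟨(leftPlane_eq n).symm, (exceptionalCurve_smallResolution hn).symm⟩

theorem intersectionComplexDual_otherResolution {n : ℕ} (hn : 1 ≤ n) :
    IntersectionComplexDual n (otherResolution n) (rightPlane n) := by
  refine intersectionComplexDual_of_parametrization (fun k => reflection n ⁻¹' k.cone n)
    (fun k => swapHomeo ⁻¹' k.stratum n) (subdivisionCones_rightPlane hn)
    (strata_otherResolution hn) (fun a b => ?_) (fun a b => ?_) (fun i => ?_) ⟨?_, ?_⟩
  · rw [(reflection n).surjective.preimage_subset_preimage_iff, Cell.cone_subset_iff hn]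
  · rw [swapHomeo.surjective.preimage_subset_preimage_iff, Cell.stratum_subset_iff hn]
  · refine ⟨Cell.ray (swapRays i), ?_, ?_⟩
    · rw [rho_eq, preimage_reflection_rho, swapRays, Equiv.swap_apply_self]
    · rw [← strictTransform_smallResolution hn, preimage_swapHomeo_strictTransform, swapRays,
        Equiv.swap_apply_self]
  · rw [preimage_reflection_plane, rightPlane_eq]
  · rw [← exceptionalCurve_smallResolution hn, exceptionalCurve, exceptionalCurve,
      ← preimage_swapHomeo_smallResolution]
    ext q
    simp only [mem_preimage, mem_ofPred_eq, swapHomeo_pt_eq_zero_iff]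

theorem mainTheorem1 (n : ℕ) (hn : 1 ≤ n) :
    (leftPlane n ≠ rightPlane n ∧ {P | IsSubdividingPlane n P} = {leftPlane n, rightPlane n}) ∧
    IntersectionComplexDual n (smallResolution n) (leftPlane n) ∧
    IntersectionComplexDual n (otherResolution n) (rightPlane n) :=
  ⟨⟨leftPlane_ne_rightPlane n, ext fun W => isSubdividingPlane_iff hn W⟩,
    intersectionComplexDual_smallResolution hn, intersectionComplexDual_otherResolution hn⟩
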